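/- Let $\beta>0$. In the linear reliability channel (LRC) with parameter $\beta$ and block length $n$, the $i$-th input bit is flipped independently with probability $q_{T(i)}$, where $q_j=\frac{e^{-\beta j/n}}{1+e^{-\beta j/n}}$ for $1\le j\le n$ and $T\in S_n$ is a uniformly random permutation. The soft-decision noise effect $N^n\in\{0,1\}^n$ is the modulo-2 sum of input and output, distributed according to its conditional law given the realization $T=\tau$: $$\Pr(N^n=z)=\prod_{i:\,z_i=1}q_{\tau(i)}\prod_{i:\,z_i=0}(1-q_{\tau(i)}).$$ The hard-decision noise effect $Z^n$ has the average of this law over all $\tau\in S_n$. An optimal guessing function for a noise effect is a bijection $G:\{0,1\}^n\to\{1,\dots,2^n\}$ that lists the binary sequences in non-increasing order of probability. For $X=N$ or $X=Z$ let $G$ denote, for each $n$, an optimal guessing function for $X^n$, and let $$\Lambda_X(\alpha)=\lim_{n\to\infty}\frac1n\ln\mathbb E\big[e^{\alpha\ln G(X^n)}\big]\quad(\alpha\in\mathbb R),\qquad I_X(x)=\sup_{\alpha\in\mathbb R}\{x\alpha-\Lambda_X(\alpha)\}\quad(0\le x\le\ln 2)$$ be the scaled cumulant generating function and the rate function of the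 guesswork process $\{n^{-1}\ln G(X^n)\}$. Let $$H_\alpha(X)=\lim_{n\to\infty}\frac1n\cdot\frac1{1-\alpha}\ln\sum_{z\in\{0,1\}^n}\Pr(X^n=z)^\alpha\quad(\alpha\in(0,1)\cup(1,\infty)),\qquad H_1(X)=\lim_{\alpha\to1}H_\alpha(X)$$ be the Rényi entropy rates and the Shannon entropy rate (in nats). All these limits exist, they do not depend on the realizations $\tau$ of $T$ or on the choice of the optimal guessing functions, and $$I_N(x)<I_Z(x)\quad\text{for }0<x\le H_1(N),\qquad I_N(x)>I_Z(x)\quad\text{for }H_1(Z)\le x\le\ln 2.$$ -/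

import Mathlib

open Filter Topology

noncomputable section

namespace LRC

/-- Binary sequences of length `n`; `true` is the bit `1`. -/
abbrev Word (n : ℕ) : Type := Fin n → Bool

/-- Bit-flip probability `q_i = e^{-β i / n} / (1 + e^{-β i / n})` of the linear reliability
channel. The index `i ∈ {1, …, n}` is `j + 1` for `j : Fin n`. -/
def flipProb (β : ℝ) (n : ℕ) (j : Fin n) : ℝ :=
  Real.exp (-β * ((j : ℝ) + 1) / n) / (1 + Real.exp (-β * ((j : ℝ) + 1) / n))

/-- Transition probability of the channel given the reliability ordering permutation `τ`:
the bits are received independently, the bit in position `i` being flipped with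
probability `q_{τ(i)}`. -/
def transition (β : ℝ) (n : ℕ) (τ : Equiv.Perm (Fin n)) (x y : Word n) : ℝ :=
  ∏ i, if y i ≠ x i then flipProb β n (τ i) else 1 - flipProb β n (τ i)

/-- PMF of the soft-decision noise effect `N^n`, the distribution of `X^n + Y^n` given that
the reliability ordering permutation is `τ`. -/
def softNoise (β : ℝ) (n : ℕ) (τ : Equiv.Perm (Fin n)) (z : Word n) : ℝ :=
  ∏ i, if z i = true then flipProb β n (τ i) else 1 - flipProb β n (τ i)

/-- Whatever the input `x` is, `softNoise` is the law of (input + output) given `τ`. -/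
theorem transition_xor (β : ℝ) (n : ℕ) (τ : Equiv.Perm (Fin n)) (x z : Word n) :
    transition β n τ x (fun i => xor (x i) (z i)) = softNoise β n τ z := by
  unfold transition softNoise
  refine Finset.prod_congr rfl fun i _ => ?_
  cases hx : x i <;> cases hz : z i <;> simp [hx, hz]

/-- PMF of the hard-decision noise effect `Z^n`: the average of the soft-decision PMF over a
uniformly distributed reliability ordering permutation. -/
def hardNoise (β : ℝ) (n : ℕ) (z : Word n) : ℝ :=
  (∑ τ : Equiv.Perm (Fin n), softNoise β n τ z) / (n.factorial : ℝ)

/-- A guessing function: a bijection from the noise effects to the positions `1, …, 2^n`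
(position `k + 1` is represented by `k : Fin (2 ^ n)`). -/
abbrev GuessFun (n : ℕ) : Type := Word n ≃ Fin (2 ^ n)

/-- `G` is an optimal guessing function for the PMF `p`: noise effects are guessed in
non-increasing order of probability. -/
def IsOptimal {n : ℕ} (p : Word n → ℝ) (G : GuessFun n) : Prop :=
  ∀ x y, G x < G y → p y ≤ p x

/-- The normalized guesswork exponent `n⁻¹ ln G(z)`. -/
def guessExponent {n : ℕ} (G : GuessFun n) (z : Word n) : ℝ :=
  (n : ℝ)⁻¹ * Real.log (((G z : ℕ) : ℝ) + 1)

/-- `Λ` is the scaled cumulant generating function of the process `A^n`, a function of a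
random word with PMF `p n`: for every real `α`, the limit of `n⁻¹ ln E[e^{α n A^n}]` exists and
equals `Λ α`. -/
def IsScgf (p A : (n : ℕ) → Word n → ℝ) (Λ : ℝ → ℝ) : Prop :=
  ∀ α : ℝ, Tendsto
    (fun n : ℕ => (n : ℝ)⁻¹ * Real.log (∑ z, p n z * Real.exp (α * n * A n z)))
    atTop (𝓝 (Λ α))

/-- The rate function attached to a scaled cumulant generating function: its
Legendre-Fenchel transform, with values in the extended reals. -/
def rateFunction (Λ : ℝ → ℝ) (x : ℝ) : EReal :=
  ⨆ α : ℝ, ((x * α - Λ α : ℝ) : EReal)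

/-- Rényi entropy (in nats) of order `α ∈ (0,1) ∪ (1,∞)`. -/
def renyiEntropy {n : ℕ} (p : Word n → ℝ) (α : ℝ) : ℝ :=
  1 / (1 - α) * Real.log (∑ z, p z ^ α)

/-- `H α` is the Rényi entropy rate of order `α`, for every `α ∈ (0,1) ∪ (1,∞)`. -/
def IsRenyiRate (p : (n : ℕ) → Word n → ℝ) (H : ℝ → ℝ) : Prop :=
  ∀ α : ℝ, 0 < α → α ≠ 1 →
    Tendsto (fun n : ℕ => (n : ℝ)⁻¹ * renyiEntropy (p n) α) atTop (𝓝 (H α))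

/-- `h` is the Shannon entropy rate `H_1 = lim_{α → 1} H_α`, where `H_α` is the Rényi entropy
rate. -/
def IsShannonRate (p : (n : ℕ) → Word n → ℝ) (h : ℝ) : Prop :=
  ∃ H : ℝ → ℝ, IsRenyiRate p H ∧ Tendsto H (𝓝[≠] 1) (𝓝 h)

end LRC

end

/-! Write M(θ,t) = ∫₀¹ ln(1 + e^{t-θu}) du (`meanSoftplus`). Everything is expressed through this
jointly convex function.

Guesswork moments reduce to power sums: since ∑ 1/G is a harmonic sum, E[G^α] equals (∑
p^{1/(1+α)})^{1+α} up to factors polynomial in n when α > -1, and equals max p up to such factors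
when α ≤ -1 (`abs_log_guess_moment_sub_le`, `abs_log_guess_moment_sub_le_of_le`). Given τ the law is
a product, so ∑ p^s has rate M(sβ,0) - s M(β,0). After averaging over τ all words of one weight are
equiprobable; their total mass is an elementary symmetric polynomial, with rate g(κ) = inf_t (M(β,t)
- tκ), and ∑ p^s has rate sup_κ [(1-s) h(κ) + s (g(κ) - M(β,0))], where h is binary entropy
(`tendsto_hardRate`).

As h(κ) = inf_t (M(0,t) - tκ), strict joint convexity of M between the levels θ = 0 and θ = β makes
the soft rate smaller for s < 1; between 0 and sβ it makes the soft rate larger for s > 1. Hence Λ_N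
< Λ_Z for α > 0 and Λ_N > Λ_Z for -1 < α < 0. Both functions vanish at 0, where their derivatives
are the Shannon rates, with H_1(N) < H_1(Z).

For 0 < x ≤ H_1(N) the supremum defining I_N is attained in (-1,0]. At a maximiser a < 0 the
comparison of Λ's is strict; at a = 0 one has I_N(x) = 0, while I_Z(x) > 0 because x is not the
slope of Λ_Z at 0. For H_1(Z) ≤ x < ln 2 the mirror argument runs on [0,∞). At x = ln 2 attainment
is replaced by comparing asymptotes as α → ∞. -/

namespace LRC

/-! ### Softplus: tangents, quadratic bounds, duality with binary entropy -/

/-- The softplus function `y ↦ ln (1 + e^y)`. -/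
noncomputable def softplus (y : ℝ) : ℝ := Real.log (1 + Real.exp y)

theorem softplus_pos (y : ℝ) : 0 < softplus y :=
  Real.log_pos (by linarith [Real.exp_pos y])

theorem exp_softplus (y : ℝ) : Real.exp (softplus y) = 1 + Real.exp y :=
  Real.exp_log (by linarith [Real.exp_pos y])

theorem softplus_zero : softplus 0 = Real.log 2 := by
  unfold softplus; norm_num

theorem self_le_softplus (y : ℝ) : y ≤ softplus y := by
  rw [← Real.exp_le_exp, exp_softplus]; linarith

theorem softplus_le_exp (y : ℝ) : softplus y ≤ Real.exp y := by
  have := Real.log_le_sub_one_of_pos (x := 1 + Real.exp y) (by linarith [Real.exp_pos y])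
  unfold softplus; linarith

theorem softplus_monotone : Monotone softplus := fun a b hab => by
  unfold softplus
  have := Real.exp_le_exp.2 hab
  exact Real.log_le_log (by linarith [Real.exp_pos a]) (by linarith)

@[fun_prop]
theorem continuous_softplus : Continuous softplus := by
  unfold softplus
  exact Continuous.log (by fun_prop) fun x => by linarith [Real.exp_pos x]

theorem sigmoid_eq (y : ℝ) : Real.sigmoid y = Real.exp y / (1 + Real.exp y) := by
  have := Real.exp_pos y
  rw [Real.sigmoid_def, Real.exp_neg]
  field_simp
  ring

/-- The right side is the moment generating function of a Bernoulli variable with mean `sigmoid y`.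
Jensen for `exp` then gives the tangent bound, and expanding `exp d` gives the matching quadratic
bound. -/
theorem exp_softplus_add_sub (y d : ℝ) :
    Real.exp (softplus (y + d) - softplus y) = 1 + Real.sigmoid y * (Real.exp d - 1) := by
  have := Real.exp_pos y
  rw [Real.exp_sub, exp_softplus, exp_softplus, sigmoid_eq, Real.exp_add]
  field_simp
  ring

theorem softplus_tangent_lt (y : ℝ) {d : ℝ} (hd : d ≠ 0) :
    softplus y + Real.sigmoid y * d < softplus (y + d) := by
  have h1 := strictConvexOn_exp.2 (Set.mem_univ 0) (Set.mem_univ d) hd.symm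
    (sub_pos.2 (Real.sigmoid_lt_one y)) (Real.sigmoid_pos y) (sub_add_cancel _ _)
  have h2 := exp_softplus_add_sub y d
  simp only [smul_eq_mul, mul_zero, zero_add, Real.exp_zero, mul_one] at h1
  have h3 : Real.exp (Real.sigmoid y * d) < Real.exp (softplus (y + d) - softplus y) := by
    rw [h2]; linarith
  linarith [Real.exp_lt_exp.1 h3]

theorem softplus_tangent_le (y d : ℝ) :
    softplus y + Real.sigmoid y * d ≤ softplus (y + d) := by
  rcases eq_or_ne d 0 with rfl | hd
  · simp
  · exact (softplus_tangent_lt y hd).le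

theorem softplus_add_le (y : ℝ) {d : ℝ} (hd : |d| ≤ 1) :
    softplus (y + d) ≤ softplus y + Real.sigmoid y * d + d ^ 2 := by
  have h2 := exp_softplus_add_sub y d
  have h3 := Real.add_one_le_exp (softplus (y + d) - softplus y)
  have h4 := (abs_le.1 (Real.abs_exp_sub_one_sub_id_le hd)).2
  have h5 : Real.sigmoid y * (Real.exp d - 1) ≤ Real.sigmoid y * (d + d ^ 2) :=
    mul_le_mul_of_nonneg_left (by linarith) (Real.sigmoid_nonneg y)
  nlinarith [Real.sigmoid_le_one y, sq_nonneg d]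

theorem strictConvexOn_softplus : StrictConvexOn ℝ Set.univ softplus := by
  refine ⟨convex_univ, fun x _ y _ hxy a b ha hb hab => ?_⟩
  simp only [smul_eq_mul]
  have hxm : x - (a * x + b * y) ≠ 0 := by
    intro h
    have : b * (x - y) = 0 := by
      have : a = 1 - b := by linarith
      subst this; linarith
    rcases mul_eq_zero.1 this with h | h
    · exact hb.ne' h
    · exact hxy (by linarith)
  have h1 := softplus_tangent_lt (a * x + b * y) hxm
  have h2 := softplus_tangent_le (a * x + b * y) (y - (a * x + b * y))
  rw [add_sub_cancel] at h1 h2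
  have h3 := mul_lt_mul_of_pos_left h1 ha
  have h4 := mul_le_mul_of_nonneg_left h2 hb.le
  have h5 : a * (softplus (a * x + b * y) +
      Real.sigmoid (a * x + b * y) * (x - (a * x + b * y))) +
      b * (softplus (a * x + b * y) +
      Real.sigmoid (a * x + b * y) * (y - (a * x + b * y))) = softplus (a * x + b * y) := by
    have : a = 1 - b := by linarith
    subst this; ring
  linarith

theorem softplus_sub_le {y d : ℝ} (hd : 0 ≤ d) : softplus y - softplus (y - d) ≤ d := by
  have h := exp_softplus_add_sub (y - d) d
  have h1 : Real.exp (softplus (y - d + d) - softplus (y - d)) ≤ Real.exp d := by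
    rw [h]
    have := Real.sigmoid_le_one (y - d)
    have h2 : (1 : ℝ) ≤ Real.exp d := Real.one_le_exp hd
    nlinarith
  have := Real.exp_le_exp.1 h1
  rwa [sub_add_cancel] at this

/-- The intercept of the tangent to softplus at t is the entropy of its slope: binary entropy is the
concave Legendre dual of softplus. -/
theorem binEntropy_sigmoid (t : ℝ) :
    Real.binEntropy (Real.sigmoid t) = softplus t - t * Real.sigmoid t := by
  have he := Real.exp_pos t
  have h1 : Real.log (Real.sigmoid t)⁻¹ = softplus t - t := by
    rw [sigmoid_eq, inv_div, Real.log_div (by positivity) (by positivity), Real.log_exp]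
    rfl
  have h2 : Real.log (1 - Real.sigmoid t)⁻¹ = softplus t := by
    have : 1 - Real.sigmoid t = (1 + Real.exp t)⁻¹ := by
      rw [sigmoid_eq]; field_simp; ring
    rw [this, inv_inv]; rfl
  rw [Real.binEntropy, h1, h2]; ring

theorem exists_sigmoid_eq {κ : ℝ} (h0 : 0 < κ) (h1 : κ < 1) : ∃ t, Real.sigmoid t = κ := by
  have : κ ∈ Set.range Real.sigmoid := by rw [Real.range_sigmoid]; exact ⟨h0, h1⟩
  exact this

theorem binEntropy_le_softplus_sub {κ : ℝ} (h0 : 0 ≤ κ) (h1 : κ ≤ 1) (t : ℝ) :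
    Real.binEntropy κ ≤ softplus t - t * κ := by
  rcases h0.eq_or_lt with rfl | h0
  · simpa using (softplus_pos t).le
  rcases h1.eq_or_lt with rfl | h1
  · simpa using self_le_softplus t
  obtain ⟨t0, rfl⟩ := exists_sigmoid_eq h0 h1
  rw [binEntropy_sigmoid]
  have := softplus_tangent_le t0 (t - t0)
  rw [add_sub_cancel] at this
  linarith

/-! ### The averaged softplus as a jointly convex function of (θ, t) -/

/-- The average `∫₀¹ ln (1 + e^{t - θ u}) du`. -/
noncomputable def meanSoftplus (θ t : ℝ) : ℝ := ∫ u in (0 : ℝ)..1, softplus (t - θ * u)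

/-- The partial derivative of `meanSoftplus` in its second variable. -/
noncomputable def meanWeight (θ t : ℝ) : ℝ := ∫ u in (0 : ℝ)..1, Real.sigmoid (t - θ * u)

/-- Minus the partial derivative of `meanSoftplus` in its first variable. -/
noncomputable def meanEnergy (θ t : ℝ) : ℝ := ∫ u in (0 : ℝ)..1, u * Real.sigmoid (t - θ * u)

theorem continuous_sigmoid_affine (θ t : ℝ) :
    Continuous fun u : ℝ => Real.sigmoid (t - θ * u) := by
  exact continuous_sigmoid.comp (by fun_prop)

theorem meanSoftplus_nonneg (θ t : ℝ) : 0 ≤ meanSoftplus θ t :=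
  intervalIntegral.integral_nonneg zero_le_one fun _ _ => (softplus_pos _).le

theorem meanSoftplus_zero_left (t : ℝ) : meanSoftplus 0 t = softplus t := by
  simp [meanSoftplus]

theorem integral_tangent (θ t p q : ℝ) :
    ∫ u in (0 : ℝ)..1, (softplus (t - θ * u) + Real.sigmoid (t - θ * u) * (p - q * u)) =
      meanSoftplus θ t + meanWeight θ t * p - meanEnergy θ t * q := by
  have hc := continuous_sigmoid_affine θ t
  have h1 : ∀ u : ℝ, softplus (t - θ * u) + Real.sigmoid (t - θ * u) * (p - q * u) =
      (softplus (t - θ * u) + p * Real.sigmoid (t - θ * u)) -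
        q * (u * Real.sigmoid (t - θ * u)) := fun u => by ring
  simp_rw [h1]
  rw [intervalIntegral.integral_sub (Continuous.intervalIntegrable (by fun_prop) _ _)
      (Continuous.intervalIntegrable (by fun_prop) _ _),
    intervalIntegral.integral_add (Continuous.intervalIntegrable (by fun_prop) _ _)
      (Continuous.intervalIntegrable (by fun_prop) _ _),
    intervalIntegral.integral_const_mul, intervalIntegral.integral_const_mul]
  unfold meanSoftplus meanWeight meanEnergy
  ring

theorem meanSoftplus_tangent_le (θ t θ' t' : ℝ) :
    meanSoftplus θ t + meanWeight θ t * (t' - t) - meanEnergy θ t * (θ' - θ) ≤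
      meanSoftplus θ' t' := by
  have hc := continuous_sigmoid_affine θ t
  rw [← integral_tangent]
  refine intervalIntegral.integral_mono_on zero_le_one
    (Continuous.intervalIntegrable (by fun_prop) _ _)
    (Continuous.intervalIntegrable (by fun_prop) _ _) fun u _ => ?_
  have := softplus_tangent_le (t - θ * u) (t' - t - (θ' - θ) * u)
  have e : t - θ * u + (t' - t - (θ' - θ) * u) = t' - θ' * u := by ring
  rwa [e] at this

/-- The increment t' - t - (θ' - θ)u is affine in u and not identically zero, so it is nonzero at u
= 0 or u = 1. Strictness at one point suffices for continuous integrands. -/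
theorem meanSoftplus_tangent_lt {θ θ' : ℝ} (h : θ ≠ θ') (t t' : ℝ) :
    meanSoftplus θ t + meanWeight θ t * (t' - t) - meanEnergy θ t * (θ' - θ) <
      meanSoftplus θ' t' := by
  have hc := continuous_sigmoid_affine θ t
  have e : ∀ u : ℝ, t - θ * u + (t' - t - (θ' - θ) * u) = t' - θ' * u := fun u => by ring
  have strict : ∀ u : ℝ, t' - t - (θ' - θ) * u ≠ 0 →
      softplus (t - θ * u) + Real.sigmoid (t - θ * u) * (t' - t - (θ' - θ) * u) <
        softplus (t' - θ' * u) := fun u hu => by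
    rw [← e]; exact softplus_tangent_lt _ hu
  rw [← integral_tangent]
  refine intervalIntegral.integral_lt_integral_of_continuousOn_of_le_of_exists_lt zero_lt_one
    (Continuous.continuousOn (by fun_prop)) (Continuous.continuousOn (by fun_prop))
    (fun u _ => ?_) ?_
  · rw [← e]; exact softplus_tangent_le _ _
  · by_cases h0 : t' - t = 0
    · exact ⟨1, by simp, strict 1 (by rw [h0, mul_one, zero_sub, neg_sub]; exact sub_ne_zero.2 h)⟩
    · exact ⟨0, by simp, strict 0 (by simpa using h0)⟩

theorem meanSoftplus_le_quadratic (θ t θ' t' : ℝ) (h : |t' - t| + |θ' - θ| ≤ 1) :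
    meanSoftplus θ' t' ≤ meanSoftplus θ t + meanWeight θ t * (t' - t) -
      meanEnergy θ t * (θ' - θ) + (|t' - t| + |θ' - θ|) ^ 2 := by
  have hc := continuous_sigmoid_affine θ t
  have e : (|t' - t| + |θ' - θ|) ^ 2 = ∫ _u in (0 : ℝ)..1, (|t' - t| + |θ' - θ|) ^ 2 := by simp
  rw [← integral_tangent, e, ← intervalIntegral.integral_add
    (Continuous.intervalIntegrable (by fun_prop) _ _)
    (Continuous.intervalIntegrable (by fun_prop) _ _)]
  refine intervalIntegral.integral_mono_on zero_le_one
    (Continuous.intervalIntegrable (by fun_prop) _ _)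
    (Continuous.intervalIntegrable (by fun_prop) _ _) fun u hu => ?_
  have hd : |t' - t - (θ' - θ) * u| ≤ |t' - t| + |θ' - θ| := by
    refine (abs_sub _ _).trans ?_
    rw [abs_mul, abs_of_nonneg hu.1]
    nlinarith [abs_nonneg (θ' - θ), hu.2]
  have := softplus_add_le (t - θ * u) (hd.trans h)
  have e : t - θ * u + (t' - t - (θ' - θ) * u) = t' - θ' * u := by ring
  rw [e] at this
  have h2 : (t' - t - (θ' - θ) * u) ^ 2 ≤ (|t' - t| + |θ' - θ|) ^ 2 := by
    rw [← sq_abs]; exact pow_le_pow_left₀ (abs_nonneg _) hd 2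
  linarith

/-- A tangent line below and a parabola above pin the derivative. This replaces differentiation
under the integral, and also applies to `hardRate`, which is only a supremum. -/
theorem hasDerivAt_of_quadratic {f : ℝ → ℝ} {x c C : ℝ}
    (h1 : ∀ᶠ y in 𝓝 x, f x + c * (y - x) ≤ f y)
    (h2 : ∀ᶠ y in 𝓝 x, f y ≤ f x + c * (y - x) + C * (y - x) ^ 2) : HasDerivAt f c x := by
  rw [hasDerivAt_iff_isLittleO]
  refine Asymptotics.IsBigO.trans_isLittleO (g := fun y => (y - x) ^ 2) ?_ ?_
  · refine Asymptotics.IsBigO.of_bound C ?_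
    filter_upwards [h1, h2] with y a b
    rw [smul_eq_mul, Real.norm_eq_abs, Real.norm_eq_abs, abs_of_nonneg (sq_nonneg (y - x)), abs_le]
    constructor <;> linarith
  · have h : Tendsto (fun y => y - x) (𝓝 x) (𝓝 0) := by
      have : Continuous fun y => y - x := by fun_prop
      simpa using this.tendsto x
    have := (Asymptotics.isLittleO_pow_id (𝕜 := ℝ) (n := 2) (by norm_num)).comp_tendsto h
    exact this

theorem eventually_abs_sub_le_one (x : ℝ) : ∀ᶠ y in 𝓝 x, |y - x| ≤ 1 := by
  filter_upwards [Metric.closedBall_mem_nhds x one_pos] with y hy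
  rwa [Metric.mem_closedBall, Real.dist_eq] at hy

theorem hasDerivAt_meanSoftplus_right (θ t : ℝ) :
    HasDerivAt (meanSoftplus θ) (meanWeight θ t) t := by
  refine hasDerivAt_of_quadratic (C := 1) (Eventually.of_forall fun y => ?_) ?_
  · simpa using meanSoftplus_tangent_le θ t θ y
  · filter_upwards [eventually_abs_sub_le_one t] with y hy
    simpa using meanSoftplus_le_quadratic θ t θ y (by simpa using hy)

theorem hasDerivAt_meanSoftplus_left (θ t : ℝ) :
    HasDerivAt (fun θ => meanSoftplus θ t) (-meanEnergy θ t) θ := by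
  refine hasDerivAt_of_quadratic (C := 1) (Eventually.of_forall fun y => ?_) ?_
  · simpa [sub_eq_add_neg] using meanSoftplus_tangent_le θ t y t
  · filter_upwards [eventually_abs_sub_le_one θ] with y hy
    simpa [sub_eq_add_neg] using meanSoftplus_le_quadratic θ t y t (by simpa using hy)

theorem meanWeight_pos (θ t : ℝ) : 0 < meanWeight θ t := by
  have hc := continuous_sigmoid_affine θ t
  exact intervalIntegral.intervalIntegral_pos_of_pos (hc.intervalIntegrable _ _)
    (fun u => Real.sigmoid_pos _) zero_lt_one

theorem meanWeight_lt_one (θ t : ℝ) : meanWeight θ t < 1 := by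
  have hc := continuous_sigmoid_affine θ t
  have : 0 < ∫ u in (0 : ℝ)..1, (1 - Real.sigmoid (t - θ * u)) :=
    intervalIntegral.intervalIntegral_pos_of_pos
      (Continuous.intervalIntegrable (by fun_prop) _ _)
      (fun u => by linarith [Real.sigmoid_lt_one (t - θ * u)]) zero_lt_one
  rw [intervalIntegral.integral_sub (Continuous.intervalIntegrable (by fun_prop) _ _)
    (hc.intervalIntegrable _ _)] at this
  simp at this
  exact this

theorem meanSoftplus_le_softplus {θ : ℝ} (hθ : 0 ≤ θ) (t : ℝ) :
    meanSoftplus θ t ≤ softplus t := by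
  have : ∫ u in (0 : ℝ)..1, softplus (t - θ * u) ≤ ∫ _u in (0 : ℝ)..1, softplus t :=
    intervalIntegral.integral_mono_on zero_le_one
      (Continuous.intervalIntegrable (by fun_prop) _ _)
      (Continuous.intervalIntegrable (by fun_prop) _ _)
      fun u hu => softplus_monotone (by nlinarith [hu.1])
  simpa [meanSoftplus] using this

theorem softplus_sub_le_meanSoftplus {θ : ℝ} (hθ : 0 ≤ θ) (t : ℝ) :
    softplus (t - θ) ≤ meanSoftplus θ t := by
  have : ∫ _u in (0 : ℝ)..1, softplus (t - θ) ≤ ∫ u in (0 : ℝ)..1, softplus (t - θ * u) :=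
    intervalIntegral.integral_mono_on zero_le_one
      (Continuous.intervalIntegrable (by fun_prop) _ _)
      (Continuous.intervalIntegrable (by fun_prop) _ _)
      fun u hu => softplus_monotone (by nlinarith [hu.2])
  simpa [meanSoftplus] using this

/-- Used near α = -1, where the effective noise parameter β/(1+α) tends to infinity. -/
theorem meanSoftplus_zero_le_inv {θ : ℝ} (hθ : 0 < θ) : meanSoftplus θ 0 ≤ 1 / θ := by
  have h1 : meanSoftplus θ 0 ≤ ∫ u in (0 : ℝ)..1, Real.exp (-θ * u) :=
    intervalIntegral.integral_mono_on zero_le_one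
      (Continuous.intervalIntegrable (by fun_prop) _ _)
      (Continuous.intervalIntegrable (by fun_prop) _ _)
      fun u _ => by simpa using softplus_le_exp (0 - θ * u)
  rw [intervalIntegral.integral_comp_mul_left (fun x => Real.exp x) (neg_ne_zero.2 hθ.ne'),
    integral_exp] at h1
  refine h1.trans ?_
  simp only [mul_one, mul_zero, Real.exp_zero, smul_eq_mul]
  rw [inv_neg, neg_mul, ← mul_neg, neg_sub, one_div]
  exact mul_le_of_le_one_right (by positivity) (by linarith [Real.exp_pos (-θ)])

/-- Strict joint convexity against the uniform noise level `θ = 0`. -/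
theorem meanSoftplus_jensen_lt {β s : ℝ} (hβ : 0 < β) (h0 : 0 < s) (h1 : s < 1) (t₀ t₁ : ℝ) :
    meanSoftplus (s * β) ((1 - s) * t₀ + s * t₁) <
      (1 - s) * softplus t₀ + s * meanSoftplus β t₁ := by
  have key : ∫ u in (0 : ℝ)..1, softplus ((1 - s) * t₀ + s * t₁ - s * β * u) <
      ∫ u in (0 : ℝ)..1, ((1 - s) * softplus t₀ + s * softplus (t₁ - β * u)) := by
    have e : ∀ u : ℝ, (1 - s) * t₀ + s * t₁ - s * β * u = (1 - s) * t₀ + s * (t₁ - β * u) :=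
      fun u => by ring
    refine intervalIntegral.integral_lt_integral_of_continuousOn_of_le_of_exists_lt zero_lt_one
      (Continuous.continuousOn (by fun_prop)) (Continuous.continuousOn (by fun_prop))
      (fun u _ => ?_) ?_
    · rw [e]
      exact strictConvexOn_softplus.convexOn.2 (Set.mem_univ t₀) (Set.mem_univ (t₁ - β * u))
        (by linarith) h0.le (by ring)
    · have strict : ∀ u : ℝ, t₀ ≠ t₁ - β * u →
          softplus ((1 - s) * t₀ + s * t₁ - s * β * u) <
            (1 - s) * softplus t₀ + s * softplus (t₁ - β * u) := fun u hu => by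
        rw [e]
        exact strictConvexOn_softplus.2 (Set.mem_univ t₀) (Set.mem_univ (t₁ - β * u)) hu
          (by linarith) h0 (by ring)
      by_cases h : t₀ = t₁ - β * 0
      · exact ⟨1, by simp, strict 1 fun h' => hβ.ne' (by linarith)⟩
      · exact ⟨0, by simp, strict 0 h⟩
  rw [intervalIntegral.integral_add (Continuous.intervalIntegrable (by fun_prop) _ _)
    (Continuous.intervalIntegrable (by fun_prop) _ _), intervalIntegral.integral_const_mul] at key
  simpa [meanSoftplus] using key

/-! ### The weight rate as a concave Legendre transform -/

/-- The exponential growth rate `inf_t (meanSoftplus θ t - t κ)` of the elementary symmetric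
polynomials of degree `κ n` in the numbers `e^{-θ j / n}`. -/
noncomputable def weightRate (θ κ : ℝ) : ℝ := ⨅ t : ℝ, (meanSoftplus θ t - t * κ)

theorem neg_le_meanSoftplus_sub {θ κ : ℝ} (hθ : 0 ≤ θ) (h0 : 0 ≤ κ) (h1 : κ ≤ 1) (t : ℝ) :
    -θ ≤ meanSoftplus θ t - t * κ := by
  rcases le_total t 0 with ht | ht
  · have := meanSoftplus_nonneg θ t
    nlinarith
  · have := (self_le_softplus _).trans (softplus_sub_le_meanSoftplus hθ t)
    nlinarith

theorem bddBelow_weightRate {θ κ : ℝ} (hθ : 0 ≤ θ) (h0 : 0 ≤ κ) (h1 : κ ≤ 1) :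
    BddBelow (Set.range fun t : ℝ => meanSoftplus θ t - t * κ) :=
  ⟨-θ, by rintro _ ⟨t, rfl⟩; exact neg_le_meanSoftplus_sub hθ h0 h1 t⟩

theorem weightRate_le {θ κ : ℝ} (hθ : 0 ≤ θ) (h0 : 0 ≤ κ) (h1 : κ ≤ 1) (t : ℝ) :
    weightRate θ κ ≤ meanSoftplus θ t - t * κ :=
  ciInf_le (bddBelow_weightRate hθ h0 h1) t

theorem continuous_meanSoftplus (θ : ℝ) : Continuous (meanSoftplus θ) :=
  continuous_iff_continuousAt.2 fun t => (hasDerivAt_meanSoftplus_right θ t).continuousAt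

/-- For κ strictly between 0 and 1 the function grows at least linearly at both ends, so it attains
its minimum; at κ = 0 or 1 this fails. -/
theorem exists_weightRate_eq {θ κ : ℝ} (hθ : 0 ≤ θ) (h0 : 0 < κ) (h1 : κ < 1) :
    ∃ t, weightRate θ κ = meanSoftplus θ t - t * κ := by
  have hcont : Continuous fun t => meanSoftplus θ t - t * κ :=
    (continuous_meanSoftplus θ).sub (by fun_prop)
  have hlim : Tendsto (fun t => meanSoftplus θ t - t * κ) (cocompact ℝ) atTop := by
    rw [cocompact_eq_atBot_atTop, tendsto_sup]
    constructor
    · refine tendsto_atTop_mono (f := fun t => -t * κ) (fun t => ?_)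
        (tendsto_neg_atBot_atTop.atTop_mul_const h0)
      linarith [meanSoftplus_nonneg θ t]
    · refine tendsto_atTop_mono (f := fun t => t * (1 - κ) + -θ) (fun t => ?_)
        (tendsto_atTop_add_const_right _ _ (tendsto_id.atTop_mul_const (by linarith)))
      have := (self_le_softplus _).trans (softplus_sub_le_meanSoftplus hθ t)
      linarith
  obtain ⟨t, ht⟩ := hcont.exists_forall_le hlim
  exact ⟨t, le_antisymm (weightRate_le hθ h0.le h1.le t) (le_ciInf ht)⟩

theorem concaveOn_weightRate {θ : ℝ} (hθ : 0 ≤ θ) :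
    ConcaveOn ℝ (Set.Icc 0 1) (weightRate θ) := by
  refine ⟨convex_Icc 0 1, fun x hx y hy a b ha hb hab => le_ciInf fun t => ?_⟩
  have h1 := mul_le_mul_of_nonneg_left (weightRate_le hθ hx.1 hx.2 t) ha
  have h2 := mul_le_mul_of_nonneg_left (weightRate_le hθ hy.1 hy.2 t) hb
  simp only [smul_eq_mul]
  have : a = 1 - b := by linarith
  subst this
  linarith

theorem continuousOn_weightRate {θ : ℝ} (hθ : 0 ≤ θ) :
    ContinuousOn (weightRate θ) (Set.Ioo 0 1) :=
  ((concaveOn_weightRate hθ).subset Set.Ioo_subset_Icc_self (convex_Ioo 0 1)).continuousOn isOpen_Ioo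

/-- An infimum of continuous functions is upper semicontinuous up to the endpoints, where concavity
alone gives no continuity. This is enough for a maximum over weights to exist. -/
theorem upperSemicontinuousOn_weightRate {θ : ℝ} (hθ : 0 ≤ θ) :
    UpperSemicontinuousOn (weightRate θ) (Set.Icc 0 1) :=
  upperSemicontinuousOn_ciInf (fun _ hκ => bddBelow_weightRate hθ hκ.1 hκ.2) fun t =>
    (Continuous.upperSemicontinuous (by fun_prop)).upperSemicontinuousOn _

/-! ### Log-concavity of elementary symmetric polynomials -/

/-- The elementary symmetric polynomial of degree `k` in the numbers `r i`, `i ∈ s`. -/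
noncomputable def esymmSum {ι : Type*} (s : Finset ι) (r : ι → ℝ) (k : ℕ) : ℝ :=
  ∑ t ∈ s.powersetCard k, ∏ i ∈ t, r i

section Esymm

variable {ι : Type*}

theorem esymmSum_nonneg (s : Finset ι) {r : ι → ℝ} (hr : ∀ i, 0 < r i) (k : ℕ) :
    0 ≤ esymmSum s r k :=
  Finset.sum_nonneg fun _ _ => Finset.prod_nonneg fun i _ => (hr i).le

theorem esymmSum_pos (s : Finset ι) {r : ι → ℝ} (hr : ∀ i, 0 < r i) {k : ℕ} (hk : k ≤ s.card) :
    0 < esymmSum s r k :=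
  Finset.sum_pos (fun _ _ => Finset.prod_pos fun i _ => hr i) (Finset.powersetCard_nonempty.2 hk)

theorem esymmSum_zero (s : Finset ι) (r : ι → ℝ) : esymmSum s r 0 = 1 := by
  simp [esymmSum]

theorem esymmSum_insert_succ [DecidableEq ι] {s : Finset ι} {a : ι} (ha : a ∉ s) (r : ι → ℝ)
    (k : ℕ) :
    esymmSum (insert a s) r (k + 1) = esymmSum s r (k + 1) + r a * esymmSum s r k := by
  unfold esymmSum
  rw [Finset.powersetCard_succ_insert ha, Finset.sum_union, Finset.sum_image, Finset.mul_sum]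
  · congr 1
    refine Finset.sum_congr rfl fun t ht => ?_
    rw [Finset.prod_insert fun h => ha ((Finset.mem_powersetCard.1 ht).1 h)]
  · intro t ht t' ht' h
    have h1 : a ∉ t := fun h => ha ((Finset.mem_powersetCard.1 ht).1 h)
    have h2 : a ∉ t' := fun h => ha ((Finset.mem_powersetCard.1 ht').1 h)
    rw [← Finset.erase_insert h1, ← Finset.erase_insert h2, h]
  · rw [Finset.disjoint_left]
    intro t ht ht'
    obtain ⟨t', _, rfl⟩ := Finset.mem_image.1 ht'
    exact ha ((Finset.mem_powersetCard.1 ht).1 (Finset.mem_insert_self a t'))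

/-- Induction on the set. After expanding the recursion in powers of `r a`, the constant and
quadratic coefficients are instances of the induction hypothesis. In the linear one a common term
cancels and the index gap to compare is wider, which is why the claim is made for all i ≤ j and not
only i = j. -/
theorem esymmSum_log_concave (s : Finset ι) {r : ι → ℝ} (hr : ∀ i, 0 < r i) :
    ∀ i j, i ≤ j → esymmSum s r i * esymmSum s r (j + 2) ≤
      esymmSum s r (i + 1) * esymmSum s r (j + 1) := by
  classical
  induction s using Finset.induction_on with
  | empty =>
    intro i j _
    have h : ∀ k, esymmSum ∅ r (k + 1) = 0 := fun k => by
      rw [esymmSum, Finset.powersetCard_eq_empty.2 (by simp), Finset.sum_empty]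
    rw [h, h, mul_zero, h, zero_mul]
  | insert a s ha ih =>
    have hn := esymmSum_nonneg s hr
    have hra := (hr a).le
    rintro (_ | i) (_ | j) hij
    · rw [esymmSum_insert_succ ha, esymmSum_insert_succ ha, esymmSum_zero]
      have := ih 0 0 le_rfl
      simp only [esymmSum_zero, zero_add] at *
      nlinarith [mul_nonneg hra (hn 1), mul_nonneg hra hra]
    · rw [esymmSum_insert_succ ha, esymmSum_insert_succ ha, esymmSum_insert_succ ha, esymmSum_zero]
      have := ih 0 (j + 1) (by omega)
      simp only [esymmSum_zero, zero_add] at *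
      have e := mul_nonneg hra (mul_nonneg (hn 1) (hn (j + 1)))
      have e' := mul_nonneg (mul_nonneg hra hra) (hn (j + 1))
      nlinarith
    · omega
    · have hij : i ≤ j := by omega
      simp only [esymmSum_insert_succ ha, show j + 1 + 2 = j + 2 + 1 from rfl]
      have h1 : esymmSum s r (i + 1) * esymmSum s r (j + 3) ≤
        esymmSum s r (i + 2) * esymmSum s r (j + 2) := ih (i + 1) (j + 1) (by omega)
      have h2 := mul_le_mul_of_nonneg_left (ih i j hij) (mul_nonneg hra hra)
      have h3 : esymmSum s r i * esymmSum s r (j + 3) ≤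
          esymmSum s r (i + 2) * esymmSum s r (j + 1) := by
        have h4 : esymmSum s r i * esymmSum s r (j + 3) ≤
          esymmSum s r (i + 1) * esymmSum s r (j + 2) := ih i (j + 1) (by omega)
        rcases hij.eq_or_lt with rfl | hlt
        · rw [mul_comm (esymmSum s r (i + 2))]; exact h4
        · exact h4.trans (by
            obtain ⟨j, rfl⟩ : ∃ j', j = j' + 1 := ⟨j - 1, by omega⟩
            exact ih (i + 1) (j + 1) (by omega))
      have h5 := mul_le_mul_of_nonneg_left h3 hra
      simp only [show j + 2 + 1 = j + 3 from rfl, show i + 1 + 1 = i + 2 from rfl,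
        show j + 1 + 1 = j + 2 from rfl]
      nlinarith

theorem sum_esymmSum_mul_pow (s : Finset ι) (r : ι → ℝ) (x : ℝ) :
    ∑ k ∈ Finset.range (s.card + 1), esymmSum s r k * x ^ k = ∏ i ∈ s, (1 + x * r i) := by
  rw [Finset.prod_one_add, Finset.sum_powerset]
  refine Finset.sum_congr rfl fun k _ => ?_
  rw [esymmSum, Finset.sum_mul]
  refine Finset.sum_congr rfl fun t ht => ?_
  rw [Finset.prod_mul_distrib, Finset.prod_const, (Finset.mem_powersetCard.1 ht).2, mul_comm]

end Esymm

/-- Every term of a positive log-concave sequence dominates after a geometric reweighting. -/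
theorem exists_dominating_weight {u : ℕ → ℝ} {n : ℕ} (hpos : ∀ k ≤ n, 0 < u k)
    (hlc : ∀ i j, i ≤ j → u i * u (j + 2) ≤ u (i + 1) * u (j + 1)) {k : ℕ} (hk : k ≤ n) :
    ∃ x : ℝ, 0 < x ∧ ∀ j ≤ n, u j * x ^ j ≤ u k * x ^ k := by
  -- The weight u m / u (m+1) makes the terms m and m+1 equal. Since consecutive ratios are
  -- non-increasing, both are then maximal; the second option covers k = n.
  have main : ∀ m, m < n → ∀ k, (k = m ∨ k = m + 1) →
      ∀ j ≤ n, u j * (u m / u (m + 1)) ^ j ≤ u k * (u m / u (m + 1)) ^ k := by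
    intro m hm
    have hm0 := hpos m hm.le
    have hm1 := hpos (m + 1) hm
    set x := u m / u (m + 1) with hx
    have hx0 : 0 < x := div_pos hm0 hm1
    have hxm : u (m + 1) * x = u m := by rw [hx]; field_simp
    have up : ∀ j, m ≤ j → j ≤ n → u j * x ^ j ≤ u m * x ^ m := by
      intro j hj
      induction j, hj using Nat.le_induction with
      | base => intro _; exact le_rfl
      | succ j hj ih =>
        intro hjn
        refine le_trans ?_ (ih (by omega))
        rw [pow_succ', ← mul_assoc]
        refine mul_le_mul_of_nonneg_right ?_ (pow_nonneg hx0.le _)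
        rcases hj.eq_or_lt with rfl | hlt
        · exact hxm.le
        · obtain ⟨j, rfl⟩ : ∃ j', j = j' + 1 := ⟨j - 1, by omega⟩
          have := hlc m j (by omega)
          rw [hx, mul_div_assoc', div_le_iff₀ hm1]
          linarith
    have down : ∀ d, d ≤ m → u (m - d) * x ^ (m - d) ≤ u m * x ^ m := by
      intro d
      induction d with
      | zero => intro _; exact le_rfl
      | succ d ih =>
        intro hd
        refine le_trans ?_ (ih (by omega))
        obtain ⟨i, hi⟩ : ∃ i, m - d = i + 1 := ⟨m - d - 1, by omega⟩
        have hi' : m - (d + 1) = i := by omega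
        rw [hi, hi', pow_succ', ← mul_assoc]
        refine mul_le_mul_of_nonneg_right ?_ (pow_nonneg hx0.le _)
        obtain ⟨m', rfl⟩ : ∃ m', m = m' + 1 := ⟨m - 1, by omega⟩
        have := hlc i m' (by omega)
        rw [hx, mul_div_assoc', le_div_iff₀ hm1]
        linarith
    have hmm : u (m + 1) * x ^ (m + 1) = u m * x ^ m := by
      rw [pow_succ', ← mul_assoc, hxm]
    have all : ∀ j ≤ n, u j * x ^ j ≤ u m * x ^ m := fun j hj => by
      rcases le_total m j with h | h
      · exact up j h hj
      · have := down (m - j) (by omega)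
        rwa [show m - (m - j) = j by omega] at this
    rintro k (rfl | rfl)
    · exact all
    · rw [hmm]; exact all
  rcases Nat.eq_zero_or_pos n with rfl | hn
  · refine ⟨1, one_pos, fun j hj => ?_⟩
    rw [show j = k by omega]
  rcases hk.eq_or_lt with rfl | hlt
  · obtain ⟨m, rfl⟩ : ∃ m, k = m + 1 := ⟨k - 1, by omega⟩
    exact ⟨_, div_pos (hpos m (by omega)) (hpos (m + 1) le_rfl),
      main m (by omega) _ (Or.inr rfl)⟩
  · exact ⟨_, div_pos (hpos k hk) (hpos (k + 1) hlt), main k hlt _ (Or.inl rfl)⟩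

/-! ### Exponential growth of the weight sums -/

/-- The integrand is decreasing, so right and left Riemann sums bracket the integral. They differ by
f 0 - f n, which is at most θ because softplus is 1-Lipschitz. -/
theorem sum_softplus_le (θ t : ℝ) (hθ : 0 ≤ θ) {n : ℕ} (hn : 0 < n) :
    ∑ j : Fin n, softplus (t + -θ * ((j : ℝ) + 1) / n) ≤ n * meanSoftplus θ t ∧
      n * meanSoftplus θ t ≤ ∑ j : Fin n, softplus (t + -θ * ((j : ℝ) + 1) / n) + θ := by
  have hn' : (0 : ℝ) < n := Nat.cast_pos.2 hn
  set f : ℝ → ℝ := fun x => softplus (t + -θ * x / n) with hf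
  have hanti : Antitone f := fun x y hxy => softplus_monotone (by
    have : -θ * y ≤ -θ * x := by nlinarith
    gcongr)
  have hint : ∫ x in (0 : ℝ)..(0 + n), f x = n * meanSoftplus θ t := by
    have h := intervalIntegral.integral_comp_mul_left (a := 0) (b := 1) f hn'.ne'
    have e : ∀ u : ℝ, f (n * u) = softplus (t - θ * u) := fun u => by
      simp only [hf]; congr 1; field_simp; ring
    simp_rw [e] at h
    rw [meanSoftplus, h, smul_eq_mul, mul_inv_cancel_left₀ hn'.ne']
    simp
  have h1 := (hanti.antitoneOn (Set.Icc 0 (0 + (n : ℝ)))).sum_le_integral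
  have h2 := (hanti.antitoneOn (Set.Icc 0 (0 + (n : ℝ)))).integral_le_sum
  rw [hint] at h1 h2
  have e1 : ∑ j : Fin n, softplus (t + -θ * ((j : ℝ) + 1) / n) =
      ∑ i ∈ Finset.range n, f (i + 1) := by
    rw [Fin.sum_univ_eq_sum_range (fun i : ℕ => softplus (t + -θ * ((i : ℝ) + 1) / n))]
  have e2 : ∑ i ∈ Finset.range n, f (i + 1) - ∑ i ∈ Finset.range n, f i = f n - f 0 := by
    have := Finset.sum_range_sub (fun i : ℕ => f i) n
    rw [Finset.sum_sub_distrib] at this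
    simpa using this
  have e3 : f 0 - f n ≤ θ := by
    have := softplus_sub_le (y := t) hθ
    simp only [hf]
    rw [mul_div_cancel_right₀ _ hn'.ne']
    simpa [sub_eq_add_neg] using this
  simp only [zero_add, Nat.cast_add, Nat.cast_one] at h1 h2
  rw [e1]
  exact ⟨h1, by linarith⟩

/-- The sum of the Boltzmann weights `∏ e^{-θ j / n}` of the words of weight `k`. -/
noncomputable def weightSum (θ : ℝ) (n k : ℕ) : ℝ :=
  esymmSum (Finset.univ : Finset (Fin n)) (fun j => Real.exp (-θ * ((j : ℝ) + 1) / n)) k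

theorem weightSum_pos (θ : ℝ) {n k : ℕ} (hk : k ≤ n) : 0 < weightSum θ n k :=
  esymmSum_pos _ (fun _ => Real.exp_pos _) (by simpa using hk)

theorem weightSum_zero_left (n k : ℕ) : weightSum 0 n k = n.choose k := by
  simp [weightSum, esymmSum]

theorem prod_one_add_exp (θ t : ℝ) (n : ℕ) :
    ∏ j : Fin n, (1 + Real.exp t * Real.exp (-θ * ((j : ℝ) + 1) / n)) =
      Real.exp (∑ j : Fin n, softplus (t + -θ * ((j : ℝ) + 1) / n)) := by
  rw [Real.exp_sum]
  refine Finset.prod_congr rfl fun j _ => ?_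
  rw [exp_softplus, Real.exp_add]

/-- Chernoff bound: one term of the generating function ∏ (1 + e^t r_j) is at most the whole. -/
theorem log_weightSum_le {θ : ℝ} (hθ : 0 ≤ θ) {n k : ℕ} (hn : 0 < n) (hk : k ≤ n) (t : ℝ) :
    Real.log (weightSum θ n k) ≤ n * meanSoftplus θ t - t * k := by
  have hpos := weightSum_pos θ hk
  have h := sum_esymmSum_mul_pow (Finset.univ : Finset (Fin n))
    (fun j => Real.exp (-θ * ((j : ℝ) + 1) / n)) (Real.exp t)
  rw [prod_one_add_exp, Finset.card_univ, Fintype.card_fin] at h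
  have h1 : weightSum θ n k * Real.exp t ^ k ≤
      Real.exp (∑ j : Fin n, softplus (t + -θ * ((j : ℝ) + 1) / n)) := by
    rw [← h]
    exact Finset.single_le_sum (f := fun k => weightSum θ n k * Real.exp t ^ k)
      (fun i _ => mul_nonneg (esymmSum_nonneg _ (fun _ => Real.exp_pos _) _) (by positivity))
      (Finset.mem_range.2 (Nat.lt_succ_of_le hk))
  have h2 := Real.log_le_log (by positivity) h1
  rw [Real.log_exp, Real.log_mul hpos.ne' (by positivity), Real.log_pow, Real.log_exp] at h2
  have := (sum_softplus_le θ t hθ hn).1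
  linarith

/-- With the dominating weight from log-concavity, the k-th of the n + 1 terms carries at least the
fraction 1/(n+1) of the generating function, so the Chernoff bound is tight at t = ln x. -/
theorem exists_le_log_weightSum {θ : ℝ} (hθ : 0 ≤ θ) {n k : ℕ} (hn : 0 < n) (hk : k ≤ n) :
    ∃ t : ℝ, n * meanSoftplus θ t - t * k - θ - Real.log (n + 1) ≤
      Real.log (weightSum θ n k) := by
  have hpos := weightSum_pos θ hk
  obtain ⟨x, hx, hdom⟩ := exists_dominating_weight (u := weightSum θ n) (n := n)
    (fun k hk => weightSum_pos θ hk) (esymmSum_log_concave _ fun _ => Real.exp_pos _) hk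
  refine ⟨Real.log x, ?_⟩
  have h := sum_esymmSum_mul_pow (Finset.univ : Finset (Fin n))
    (fun j => Real.exp (-θ * ((j : ℝ) + 1) / n)) (Real.exp (Real.log x))
  rw [prod_one_add_exp, Finset.card_univ, Fintype.card_fin] at h
  have h1 : Real.exp (∑ j : Fin n, softplus (Real.log x + -θ * ((j : ℝ) + 1) / n)) ≤
      (n + 1) * (weightSum θ n k * x ^ k) := by
    rw [← h, Real.exp_log hx]
    have := Finset.sum_le_card_nsmul (Finset.range (n + 1)) (fun k => weightSum θ n k * x ^ k)
      (weightSum θ n k * x ^ k)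
      fun j hj => hdom j (Nat.lt_succ_iff.1 (Finset.mem_range.1 hj))
    simp only [Finset.card_range, nsmul_eq_mul, Nat.cast_add, Nat.cast_one] at this
    exact this
  have h2 := Real.log_le_log (Real.exp_pos _) h1
  rw [Real.log_exp, Real.log_mul (by positivity) (by positivity),
    Real.log_mul hpos.ne' (by positivity), Real.log_pow] at h2
  have := (sum_softplus_le θ (Real.log x) hθ hn).2
  linarith

theorem inv_mul_log_weightSum_le {θ : ℝ} (hθ : 0 ≤ θ) {n k : ℕ} (hn : 0 < n) (hk : k ≤ n) :
    (n : ℝ)⁻¹ * Real.log (weightSum θ n k) ≤ weightRate θ (k / n) := by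
  have hn' : (0 : ℝ) < n := Nat.cast_pos.2 hn
  refine le_ciInf fun t => ?_
  rw [inv_mul_le_iff₀ hn']
  have := log_weightSum_le hθ hn hk t
  have e : (n : ℝ) * (meanSoftplus θ t - t * (k / n)) = n * meanSoftplus θ t - t * k := by
    field_simp
  linarith

theorem weightRate_sub_le {θ : ℝ} (hθ : 0 ≤ θ) {n k : ℕ} (hn : 0 < n) (hk : k ≤ n) :
    weightRate θ (k / n) - (n : ℝ)⁻¹ * (θ + Real.log (n + 1)) ≤
      (n : ℝ)⁻¹ * Real.log (weightSum θ n k) := by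
  have hn' : (0 : ℝ) < n := Nat.cast_pos.2 hn
  obtain ⟨t, ht⟩ := exists_le_log_weightSum hθ hn hk
  have h1 := weightRate_le hθ (κ := (k : ℝ) / n) (by positivity)
    (div_le_one_of_le₀ (Nat.cast_le.2 hk) hn'.le) t
  have h2 := mul_le_mul_of_nonneg_left ht (inv_nonneg.2 hn'.le)
  have e : (n : ℝ)⁻¹ * (n * meanSoftplus θ t - t * k - θ - Real.log (n + 1)) =
      meanSoftplus θ t - t * (k / n) - (n : ℝ)⁻¹ * (θ + Real.log (n + 1)) := by
    field_simp
    ring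
  linarith

/-- This is the case θ = 0 of the weight sums; the endpoints are separate because they are not
values of the sigmoid. -/
theorem inv_mul_log_choose_le {n k : ℕ} (hn : 0 < n) (hk : k ≤ n) :
    (n : ℝ)⁻¹ * Real.log (n.choose k) ≤ Real.binEntropy (k / n) := by
  have hn' : (0 : ℝ) < n := Nat.cast_pos.2 hn
  rcases Nat.eq_zero_or_pos k with rfl | hk0
  · simp
  rcases hk.eq_or_lt with rfl | hkn
  · simp [hn'.ne']
  have h1 : (0 : ℝ) < (k : ℝ) / n := div_pos (Nat.cast_pos.2 hk0) hn'
  have h2 : (k : ℝ) / n < 1 := by rw [div_lt_one hn']; exact_mod_cast hkn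
  obtain ⟨t, ht⟩ := exists_sigmoid_eq h1 h2
  have h3 := inv_mul_log_weightSum_le le_rfl hn hk
  rw [weightSum_zero_left] at h3
  refine h3.trans ((weightRate_le le_rfl h1.le h2.le t).trans ?_)
  rw [meanSoftplus_zero_left, ← ht, binEntropy_sigmoid]

theorem binEntropy_sub_le {n k : ℕ} (hn : 0 < n) (hk : k ≤ n) :
    Real.binEntropy (k / n) - (n : ℝ)⁻¹ * Real.log (n + 1) ≤
      (n : ℝ)⁻¹ * Real.log (n.choose k) := by
  have hn' : (0 : ℝ) < n := Nat.cast_pos.2 hn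
  have h3 := weightRate_sub_le le_rfl hn hk
  rw [weightSum_zero_left, zero_add] at h3
  refine le_trans (sub_le_sub_right (le_ciInf fun t => ?_) _) h3
  rw [meanSoftplus_zero_left]
  exact binEntropy_le_softplus_sub (by positivity)
    (div_le_one_of_le₀ (Nat.cast_le.2 hk) hn'.le) t

/-! ### Guesswork moments and power sums -/

theorem sum_rpow_mul_rpow_le {ι : Type*} (s : Finset ι) {x y : ι → ℝ} (hx : ∀ i, 0 ≤ x i)
    (hy : ∀ i, 0 ≤ y i) {a b : ℝ} (ha : 0 < a) (hb : 0 < b) (hab : a + b = 1) :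
    ∑ i ∈ s, x i ^ a * y i ^ b ≤ (∑ i ∈ s, x i) ^ a * (∑ i ∈ s, y i) ^ b := by
  have h := Real.inner_le_Lp_mul_Lq_of_nonneg s (Real.HolderConjugate.inv_inv ha hb hab)
    (f := fun i => x i ^ a) (g := fun i => y i ^ b)
    (fun i _ => Real.rpow_nonneg (hx i) _) (fun i _ => Real.rpow_nonneg (hy i) _)
  have e1 : ∀ i, (x i ^ a) ^ a⁻¹ = x i := fun i => by
    rw [← Real.rpow_mul (hx i), mul_inv_cancel₀ ha.ne', Real.rpow_one]
  have e2 : ∀ i, (y i ^ b) ^ b⁻¹ = y i := fun i => by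
    rw [← Real.rpow_mul (hy i), mul_inv_cancel₀ hb.ne', Real.rpow_one]
  simpa only [e1, e2, one_div, inv_inv] using h

section Guesswork

variable {Ω : Type*} [Fintype Ω] {N : ℕ}

theorem sum_inv_guess_le (G : Ω ≃ Fin N) :
    ∑ z, (((G z : ℕ) : ℝ) + 1)⁻¹ ≤ 1 + Real.log N := by
  have h := harmonic_le_one_add_log N
  refine le_trans (le_of_eq ?_) h
  rw [Equiv.sum_comp G (fun k : Fin N => (((k : ℕ) : ℝ) + 1)⁻¹),
    Fin.sum_univ_eq_sum_range (fun k : ℕ => ((k : ℝ) + 1)⁻¹), harmonic]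
  push_cast
  rfl

theorem one_le_one_add_log (hN : 0 < N) : (1 : ℝ) ≤ 1 + Real.log N := by
  have := Real.log_nonneg (x := N) (by exact_mod_cast hN)
  linarith

variable {p : Ω → ℝ} {G : Ω ≃ Fin N}

/-- The words guessed no later than z number `G z + 1` (positions start at 0), and each is at least
as likely as z. -/
theorem guess_mul_rpow_le (hp : ∀ z, 0 < p z) (hG : ∀ x y, G x < G y → p y ≤ p x) {s : ℝ}
    (hs : 0 < s) (z : Ω) : (((G z : ℕ) : ℝ) + 1) * p z ^ s ≤ ∑ w, p w ^ s := by
  classical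
  have hcard : (Finset.univ.filter fun w => G w ≤ G z).card = (G z : ℕ) + 1 := by
    have : (Finset.univ.filter fun w => G w ≤ G z).map G.toEmbedding = Finset.Iic (G z) := by
      ext k
      simp only [Finset.mem_map_equiv, Finset.mem_filter, Finset.mem_univ, true_and,
        Equiv.apply_symm_apply, Finset.mem_Iic]
    rw [← Finset.card_map G.toEmbedding, this, Fin.card_Iic]
  have h1 := Finset.card_nsmul_le_sum (Finset.univ.filter fun w => G w ≤ G z)
    (fun w => p w ^ s) (p z ^ s) fun w hw => by
      refine Real.rpow_le_rpow (hp z).le ?_ hs.le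
      rcases (Finset.mem_filter.1 hw).2.lt_or_eq with h | h
      · exact hG w z h
      · rw [G.injective h]
  rw [hcard, nsmul_eq_mul] at h1
  push_cast at h1
  exact h1.trans (Finset.sum_le_sum_of_subset_of_nonneg (Finset.filter_subset _ _)
    fun w _ _ => Real.rpow_nonneg (hp w).le _)

/-- Arıkan's argument. One side inserts the pointwise bound on the guess position; the other is
Hölder against the harmonic sum of 1/G. The sign of α decides which of the two gives the upper
bound. -/
theorem abs_log_guess_moment_sub_le [Nonempty Ω] (hp : ∀ z, 0 < p z)
    (hG : ∀ x y, G x < G y → p y ≤ p x) {α : ℝ} (hα : -1 < α) :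
    |Real.log (∑ z, p z * (((G z : ℕ) : ℝ) + 1) ^ α) -
      (1 + α) * Real.log (∑ z, p z ^ (1 / (1 + α)))| ≤ |α| * Real.log (1 + Real.log N) := by
  have hN : 0 < N := (Fin.pos (G (Classical.arbitrary Ω)))
  have hH := one_le_one_add_log hN
  have hk : ∀ z, (0 : ℝ) < ((G z : ℕ) : ℝ) + 1 := fun z => by positivity
  have h1α : 0 < 1 + α := by linarith
  have hs : 0 < 1 / (1 + α) := by positivity
  set s := 1 / (1 + α) with hsdef
  have hs1 : 1 - s * α = s := by rw [hsdef]; field_simp; ring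
  set S := ∑ z, p z ^ s with hS
  set E := ∑ z, p z * (((G z : ℕ) : ℝ) + 1) ^ α with hE
  have hS0 : 0 < S := Finset.sum_pos (fun z _ => Real.rpow_pos_of_pos (hp z) _)
    Finset.univ_nonempty
  have hE0 : 0 < E := Finset.sum_pos
    (fun z _ => mul_pos (hp z) (Real.rpow_pos_of_pos (hk z) _)) Finset.univ_nonempty
  have hHs := sum_inv_guess_le G
  have hlogH : 0 ≤ Real.log (1 + Real.log N) := Real.log_nonneg hH
  have hkS : ∀ z, ((G z : ℕ) : ℝ) + 1 ≤ S * p z ^ (-s) := fun z => by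
    rw [Real.rpow_neg (hp z).le, ← div_eq_mul_inv, le_div_iff₀ (Real.rpow_pos_of_pos (hp z) _)]
    exact guess_mul_rpow_le hp hG hs z
  have hpow : ∑ z, p z * (S * p z ^ (-s)) ^ α = S ^ (1 + α) := by
    rw [add_comm 1 α, Real.rpow_add hS0, Real.rpow_one]
    nth_rewrite 3 [hS]
    rw [Finset.mul_sum]
    refine Finset.sum_congr rfl fun z _ => ?_
    rw [Real.mul_rpow hS0.le (Real.rpow_nonneg (hp z).le _), ← Real.rpow_mul (hp z).le,
      mul_left_comm]
    congr 1
    nth_rewrite 1 [← Real.rpow_one (p z)]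
    rw [← Real.rpow_add (hp z)]
    congr 1
    linarith
  have hlogS : Real.log (S ^ (1 + α)) = (1 + α) * Real.log S := Real.log_rpow hS0 _
  rw [abs_le]
  rcases lt_trichotomy α 0 with h0 | rfl | h0
  · have a1 : S ^ (1 + α) ≤ E := by
      rw [← hpow]
      refine Finset.sum_le_sum fun z _ => mul_le_mul_of_nonneg_left ?_ (hp z).le
      exact Real.rpow_le_rpow_of_nonpos (hk z) (hkS z) h0.le
    have a2 : E ≤ S ^ (1 + α) * (1 + Real.log N) ^ (-α) := by
      have := sum_rpow_mul_rpow_le Finset.univ (x := fun z => p z ^ s)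
        (y := fun z => (((G z : ℕ) : ℝ) + 1)⁻¹) (fun z => Real.rpow_nonneg (hp z).le _)
        (fun z => (inv_pos.2 (hk z)).le) h1α (neg_pos.2 h0) (by ring)
      refine le_trans (le_of_eq ?_) (this.trans (mul_le_mul_of_nonneg_left
        (Real.rpow_le_rpow (Finset.sum_nonneg fun z _ => (inv_pos.2 (hk z)).le) hHs
          (neg_pos.2 h0).le) (Real.rpow_nonneg hS0.le _)))
      refine Finset.sum_congr rfl fun z _ => ?_
      rw [← Real.rpow_mul (hp z).le, show s * (1 + α) = 1 by rw [hsdef]; field_simp,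
        Real.rpow_one, Real.inv_rpow (hk z).le, Real.rpow_neg (hk z).le, inv_inv]
    have b1 := Real.log_le_log (Real.rpow_pos_of_pos hS0 _) a1
    have b2 := Real.log_le_log hE0 a2
    rw [Real.log_mul (Real.rpow_pos_of_pos hS0 _).ne'
      (Real.rpow_pos_of_pos (by linarith) _).ne', hlogS,
      Real.log_rpow (zero_lt_one.trans_le hH)] at b2
    rw [abs_of_neg h0]
    constructor
    · nlinarith
    · linarith
  · simp [hE, hS, hsdef]
  · have a1 : E ≤ S ^ (1 + α) := by
      rw [← hpow]
      refine Finset.sum_le_sum fun z _ => mul_le_mul_of_nonneg_left ?_ (hp z).le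
      exact Real.rpow_le_rpow (hk z).le (hkS z) h0.le
    have hsα : 0 < s * α := mul_pos hs h0
    have a2 : S ≤ E ^ s * (1 + Real.log N) ^ (s * α) := by
      have := sum_rpow_mul_rpow_le Finset.univ (x := fun z => p z * (((G z : ℕ) : ℝ) + 1) ^ α)
        (y := fun z => (((G z : ℕ) : ℝ) + 1)⁻¹)
        (fun z => mul_nonneg (hp z).le (Real.rpow_nonneg (hk z).le _))
        (fun z => (inv_pos.2 (hk z)).le) hs hsα (by linarith)
      refine le_trans (le_of_eq ?_) (this.trans (mul_le_mul_of_nonneg_left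
        (Real.rpow_le_rpow (Finset.sum_nonneg fun z _ => (inv_pos.2 (hk z)).le) hHs
          hsα.le) (Real.rpow_nonneg hE0.le _)))
      refine Finset.sum_congr rfl fun z _ => ?_
      rw [Real.mul_rpow (hp z).le (Real.rpow_nonneg (hk z).le _), ← Real.rpow_mul (hk z).le,
        Real.inv_rpow (hk z).le, mul_comm α s, mul_assoc,
        mul_inv_cancel₀ (Real.rpow_pos_of_pos (hk z) _).ne', mul_one]
    have b1 := Real.log_le_log hE0 a1
    have b2 := Real.log_le_log hS0 a2
    rw [Real.log_mul (Real.rpow_pos_of_pos hE0 _).ne'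
      (Real.rpow_pos_of_pos (by linarith) _).ne', Real.log_rpow (zero_lt_one.trans_le hH),
      Real.log_rpow hE0] at b2
    rw [abs_of_pos h0]
    have b3 := mul_le_mul_of_nonneg_left b2 h1α.le
    have e : (1 + α) * (s * Real.log E + s * α * Real.log (1 + Real.log N)) =
        Real.log E + α * Real.log (1 + Real.log N) := by
      rw [hsdef]; field_simp
    constructor
    · linarith
    · nlinarith

/-- Here k^α ≤ 1/k, so the sum lies between its first term, which has maximal probability, and that
probability times the harmonic sum. -/
theorem abs_log_guess_moment_sub_le_of_le (hp : ∀ z, 0 < p z)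
    (hG : ∀ x y, G x < G y → p y ≤ p x) {α : ℝ} (hα : α ≤ -1) (z₀ : Ω) (hz₀ : ∀ z, p z ≤ p z₀) :
    |Real.log (∑ z, p z * (((G z : ℕ) : ℝ) + 1) ^ α) - Real.log (p z₀)| ≤
      Real.log (1 + Real.log N) := by
  have hN : 0 < N := Fin.pos (G z₀)
  have hH := one_le_one_add_log hN
  have hk : ∀ z, (0 : ℝ) < ((G z : ℕ) : ℝ) + 1 := fun z => by positivity
  have hlogH : 0 ≤ Real.log (1 + Real.log N) := Real.log_nonneg hH
  set E := ∑ z, p z * (((G z : ℕ) : ℝ) + 1) ^ α with hE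
  have a1 : p z₀ ≤ E := by
    set z₁ := G.symm ⟨0, hN⟩ with hz₁
    have h1 : p z₀ ≤ p z₁ := by
      have hle : G z₁ ≤ G z₀ := by
        rw [hz₁, Equiv.apply_symm_apply]; exact Fin.mk_le_of_le_val (Nat.zero_le _)
      rcases hle.lt_or_eq with h | h
      · exact hG _ _ h
      · rw [G.injective h]
    refine h1.trans ?_
    have h2 := Finset.single_le_sum (f := fun z => p z * (((G z : ℕ) : ℝ) + 1) ^ α)
      (fun z _ => mul_nonneg (hp z).le (Real.rpow_nonneg (hk z).le _)) (Finset.mem_univ z₁)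
    simpa [hz₁] using h2
  have a2 : E ≤ p z₀ * (1 + Real.log N) := by
    refine le_trans ?_ (mul_le_mul_of_nonneg_left (sum_inv_guess_le G) (hp z₀).le)
    rw [Finset.mul_sum]
    refine Finset.sum_le_sum fun z _ => mul_le_mul (hz₀ z) ?_ (Real.rpow_nonneg (hk z).le _)
      (hp z₀).le
    rw [← Real.rpow_neg_one]
    exact Real.rpow_le_rpow_of_exponent_le (by linarith [Nat.cast_nonneg (α := ℝ) (G z : ℕ)]) hα
  have b1 := Real.log_le_log (hp z₀) a1
  have b2 := Real.log_le_log ((hp z₀).trans_le a1) a2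
  rw [Real.log_mul (hp z₀).ne' (by linarith)] at b2
  rw [abs_le]
  constructor <;> linarith

end Guesswork

/-! ### Scaled cumulant generating functions as limits -/

theorem sum_mul_exp_guessExponent {n : ℕ} (hn : 0 < n) (p : Word n → ℝ) (G : GuessFun n) (α : ℝ) :
    ∑ z, p z * Real.exp (α * n * guessExponent G z) =
      ∑ z, p z * (((G z : ℕ) : ℝ) + 1) ^ α := by
  have hn' : (n : ℝ) ≠ 0 := Nat.cast_ne_zero.2 hn.ne'
  refine Finset.sum_congr rfl fun z _ => ?_
  rw [guessExponent, mul_assoc, mul_inv_cancel_left₀ hn',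
    Real.rpow_def_of_pos (by positivity), mul_comm α]

theorem tendsto_inv_mul_log_add_one :
    Tendsto (fun n : ℕ => (n : ℝ)⁻¹ * Real.log ((n : ℝ) + 1)) atTop (𝓝 0) := by
  have h1 : Tendsto (fun n : ℕ => Real.log ((n : ℝ) + 1) / ((n : ℝ) + 1)) atTop (𝓝 0) := by
    have h : Tendsto (fun x : ℝ => Real.log x / x) atTop (𝓝 0) :=
      Real.isLittleO_log_id_atTop.tendsto_div_nhds_zero
    exact h.comp (tendsto_atTop_add_const_right _ _ tendsto_natCast_atTop_atTop)
  have h2 : Tendsto (fun n : ℕ => 2 * (Real.log ((n : ℝ) + 1) / ((n : ℝ) + 1))) atTop (𝓝 0) := by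
    simpa using h1.const_mul 2
  refine squeeze_zero' (Eventually.of_forall fun n => ?_) ?_ h2
  · exact mul_nonneg (by positivity) (Real.log_nonneg (by linarith [Nat.cast_nonneg (α := ℝ) n]))
  · filter_upwards [eventually_ge_atTop 1] with n hn
    have hn1 : (1 : ℝ) ≤ n := by exact_mod_cast hn
    have h4 : 0 ≤ Real.log ((n : ℝ) + 1) := Real.log_nonneg (by linarith)
    have h5 : (n : ℝ)⁻¹ ≤ 2 / (n + 1) := by
      rw [inv_eq_one_div, div_le_div_iff₀ (by linarith) (by linarith)]
      linarith
    calc (n : ℝ)⁻¹ * Real.log (n + 1) ≤ 2 / (n + 1) * Real.log (n + 1) :=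
          mul_le_mul_of_nonneg_right h5 h4
      _ = 2 * (Real.log (n + 1) / (n + 1)) := by ring

theorem tendsto_inv_mul_log_one_add_log :
    Tendsto (fun n : ℕ => (n : ℝ)⁻¹ * Real.log (1 + Real.log ((2 ^ n : ℕ) : ℝ))) atTop (𝓝 0) := by
  refine squeeze_zero (fun n => ?_) (fun n => ?_) tendsto_inv_mul_log_add_one
  · exact mul_nonneg (by positivity) (Real.log_nonneg (one_le_one_add_log (by positivity)))
  · have hlog2 : Real.log 2 ≤ 1 := by
      have := Real.log_le_sub_one_of_pos (x := 2) (by norm_num)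
      linarith
    have hlog2' : 0 ≤ Real.log 2 := Real.log_nonneg (by norm_num)
    have hn : (0 : ℝ) ≤ n := Nat.cast_nonneg n
    push_cast
    rw [Real.log_pow]
    exact mul_le_mul_of_nonneg_left (Real.log_le_log (by positivity) (by nlinarith))
      (inv_nonneg.2 hn)

/-- The scaled cumulant generating function of the guesswork process of a source whose power sums
`∑ p ^ s` grow with exponential rate `R s` and whose maximal probability has rate `m`. -/
noncomputable def guessScgf (R : ℝ → ℝ) (m α : ℝ) : ℝ :=
  if -1 < α then (1 + α) * R (1 / (1 + α)) else m

theorem tendsto_of_abs_sub_le {u v e : ℕ → ℝ} {l : ℝ} (hv : Tendsto v atTop (𝓝 l))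
    (he : Tendsto e atTop (𝓝 0)) (h : ∀ᶠ n in atTop, |u n - v n| ≤ e n) :
    Tendsto u atTop (𝓝 l) := by
  have h1 : Tendsto (fun n => u n - v n) atTop (𝓝 0) :=
    squeeze_zero_norm' (by simpa only [Real.norm_eq_abs] using h) he
  simpa using h1.add hv

theorem isScgf_guessScgf {p : (n : ℕ) → Word n → ℝ} (hp : ∀ n z, 0 < p n z) {R : ℝ → ℝ}
    (hR : ∀ s, 0 < s → Tendsto (fun n : ℕ => (n : ℝ)⁻¹ * Real.log (∑ z, p n z ^ s)) atTop
      (𝓝 (R s)))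
    {m : ℝ} (z₀ : (n : ℕ) → Word n) (hz₀ : ∀ n z, p n z ≤ p n (z₀ n))
    (hm : Tendsto (fun n : ℕ => (n : ℝ)⁻¹ * Real.log (p n (z₀ n))) atTop (𝓝 m))
    (G : (n : ℕ) → GuessFun n) (hG : ∀ n, IsOptimal (p n) (G n)) :
    IsScgf p (fun n => guessExponent (G n)) (guessScgf R m) := by
  intro α
  have hH := tendsto_inv_mul_log_one_add_log
  unfold guessScgf
  split_ifs with hα
  · have hs : 0 < 1 / (1 + α) := one_div_pos.2 (by linarith)
    refine tendsto_of_abs_sub_le ((hR _ hs).const_mul (1 + α))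
      (by have := hH.const_mul |α|; rwa [mul_zero] at this) ?_
    filter_upwards [eventually_ge_atTop 1] with n hn
    have hn' : (0 : ℝ) ≤ (n : ℝ)⁻¹ := by positivity
    have := mul_le_mul_of_nonneg_left (abs_log_guess_moment_sub_le (hp n) (hG n) hα) hn'
    rw [sum_mul_exp_guessExponent hn, mul_left_comm (1 + α), ← mul_sub, abs_mul,
      abs_of_nonneg hn', mul_left_comm |α|]
    exact this
  · refine tendsto_of_abs_sub_le hm hH ?_
    filter_upwards [eventually_ge_atTop 1] with n hn
    have hn' : (0 : ℝ) ≤ (n : ℝ)⁻¹ := by positivity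
    have := mul_le_mul_of_nonneg_left
      (abs_log_guess_moment_sub_le_of_le (hp n) (hG n) (not_lt.1 hα) (z₀ n) (hz₀ n)) hn'
    rw [sum_mul_exp_guessExponent hn, ← mul_sub, abs_mul, abs_of_nonneg hn']
    exact this

/-- Sorting provides a guesswork process whose limit is the explicit function; convexity of that
function is then inherited from log-moment generating functions. -/
theorem exists_isOptimal {n : ℕ} (p : Word n → ℝ) : ∃ G : GuessFun n, IsOptimal p G := by
  have e : Word n ≃ Fin (2 ^ n) := Fintype.equivFinOfCardEq (by simp)
  set σ := Tuple.sort (fun k => -p (e.symm k)) with hσ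
  have hmono : Monotone ((fun k => -p (e.symm k)) ∘ σ) := Tuple.monotone_sort _
  refine ⟨e.trans σ.symm, fun x y hxy => ?_⟩
  have := hmono hxy.le
  simpa using this

theorem convexOn_log_sum_exp {ι : Type*} [Fintype ι] [Nonempty ι] {p : ι → ℝ} (hp : ∀ z, 0 < p z)
    (c : ι → ℝ) : ConvexOn ℝ Set.univ fun α : ℝ => Real.log (∑ z, p z * Real.exp (α * c z)) := by
  have hpos : ∀ α z, 0 < p z * Real.exp (α * c z) := fun α z => mul_pos (hp z) (Real.exp_pos _)
  have hsum : ∀ α, 0 < ∑ z, p z * Real.exp (α * c z) := fun α =>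
    Finset.sum_pos (fun z _ => hpos α z) Finset.univ_nonempty
  rw [convexOn_iff_forall_pos]
  refine ⟨convex_univ, fun x _ y _ a b ha hb hab => ?_⟩
  have h := sum_rpow_mul_rpow_le Finset.univ (fun z => (hpos x z).le) (fun z => (hpos y z).le)
    ha hb hab
  have e : ∀ z, (p z * Real.exp (x * c z)) ^ a * (p z * Real.exp (y * c z)) ^ b =
      p z * Real.exp ((a * x + b * y) * c z) := fun z => by
    rw [Real.mul_rpow (hp z).le (Real.exp_pos _).le, Real.mul_rpow (hp z).le (Real.exp_pos _).le,
      mul_mul_mul_comm, ← Real.rpow_add (hp z), hab, Real.rpow_one, ← Real.exp_mul,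
      ← Real.exp_mul, ← Real.exp_add]
    ring_nf
  simp only [e] at h
  have h2 := Real.log_le_log (hsum _) h
  rw [Real.log_mul (Real.rpow_pos_of_pos (hsum _) _).ne' (Real.rpow_pos_of_pos (hsum _) _).ne',
    Real.log_rpow (hsum _), Real.log_rpow (hsum _)] at h2
  simpa using h2

theorem convexOn_of_isScgf {p A : (n : ℕ) → Word n → ℝ} (hp : ∀ n z, 0 < p n z) {Λ : ℝ → ℝ}
    (h : IsScgf p A Λ) : ConvexOn ℝ Set.univ Λ := by
  refine ⟨convex_univ, fun x _ y _ a b ha hb hab => ?_⟩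
  have h1 : Tendsto (fun n : ℕ => a * ((n : ℝ)⁻¹ * Real.log (∑ z, p n z * Real.exp (x * n * A n z)))
      + b * ((n : ℝ)⁻¹ * Real.log (∑ z, p n z * Real.exp (y * n * A n z)))) atTop
      (𝓝 (a * Λ x + b * Λ y)) := ((h x).const_mul a).add ((h y).const_mul b)
  refine le_of_tendsto_of_tendsto' (h (a • x + b • y)) h1 fun n => ?_
  have h2 := (convexOn_log_sum_exp (hp n) fun z => n * A n z).2 (Set.mem_univ x) (Set.mem_univ y)
    ha hb hab
  simp only [smul_eq_mul, ← mul_assoc] at h2 ⊢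
  have h3 := mul_le_mul_of_nonneg_left h2 (by positivity : (0 : ℝ) ≤ (n : ℝ)⁻¹)
  refine h3.trans (le_of_eq ?_)
  ring

/-! ### Power sums of the soft-decision noise -/

/-- The log-partition function `∑ ln (1 + e^{-θ j / n})` of the channel. -/
noncomputable def logPartition (θ : ℝ) (n : ℕ) : ℝ :=
  ∑ j : Fin n, softplus (0 + -θ * ((j : ℝ) + 1) / n)

theorem flipProb_eq (β : ℝ) (n : ℕ) (j : Fin n) :
    flipProb β n j = Real.exp (-β * ((j : ℝ) + 1) / n) *
      Real.exp (-softplus (0 + -β * ((j : ℝ) + 1) / n)) := by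
  rw [flipProb, Real.exp_neg (softplus _), exp_softplus, zero_add, div_eq_mul_inv]

theorem one_sub_flipProb_eq (β : ℝ) (n : ℕ) (j : Fin n) :
    1 - flipProb β n j = Real.exp (-softplus (0 + -β * ((j : ℝ) + 1) / n)) := by
  rw [flipProb, Real.exp_neg (softplus _), exp_softplus, zero_add]
  have := Real.exp_pos (-β * ((j : ℝ) + 1) / n)
  field_simp
  ring

theorem flipProb_pos (β : ℝ) (n : ℕ) (j : Fin n) : 0 < flipProb β n j := by
  rw [flipProb_eq]; positivity

theorem one_sub_flipProb_pos (β : ℝ) (n : ℕ) (j : Fin n) : 0 < 1 - flipProb β n j := by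
  rw [one_sub_flipProb_eq]; positivity

theorem softNoise_pos (β : ℝ) (n : ℕ) (τ : Equiv.Perm (Fin n)) (z : Word n) :
    0 < softNoise β n τ z :=
  Finset.prod_pos fun i _ => by
    split_ifs
    · exact flipProb_pos β n _
    · exact one_sub_flipProb_pos β n _

theorem softNoise_eq_exp_mul (β : ℝ) (n : ℕ) (τ : Equiv.Perm (Fin n)) (z : Word n) :
    softNoise β n τ z = Real.exp (-logPartition β n) *
      ∏ i ∈ Finset.univ.filter (fun i => z i = true),
        Real.exp (-β * ((τ i : ℝ) + 1) / n) := by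
  have h1 : softNoise β n τ z =
      ∏ i, (Real.exp (-softplus (0 + -β * ((τ i : ℝ) + 1) / n)) *
        if z i = true then Real.exp (-β * ((τ i : ℝ) + 1) / n) else 1) := by
    refine Finset.prod_congr rfl fun i _ => ?_
    split_ifs
    · rw [flipProb_eq, mul_comm]
    · rw [one_sub_flipProb_eq, mul_one]
  rw [h1, Finset.prod_mul_distrib, Finset.prod_filter,
    Equiv.prod_comp τ fun j : Fin n => Real.exp (-softplus (0 + -β * ((j : ℝ) + 1) / n)),
    ← Real.exp_sum, Finset.sum_neg_distrib]
  rfl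

theorem softNoise_zero (β : ℝ) (n : ℕ) (τ : Equiv.Perm (Fin n)) :
    softNoise β n τ (fun _ => false) = Real.exp (-logPartition β n) := by
  simp [softNoise_eq_exp_mul]

theorem softNoise_le_zero {β : ℝ} (hβ : 0 < β) (n : ℕ) (τ : Equiv.Perm (Fin n)) (z : Word n) :
    softNoise β n τ z ≤ softNoise β n τ fun _ => false := by
  rw [softNoise_zero, softNoise_eq_exp_mul]
  refine mul_le_of_le_one_right (Real.exp_pos _).le
    (Finset.prod_le_one (fun _ _ => (Real.exp_pos _).le) fun i _ => ?_)
  rw [Real.exp_le_one_iff, neg_mul, neg_div, neg_nonpos]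
  positivity

theorem tendsto_logPartition {θ : ℝ} (hθ : 0 ≤ θ) :
    Tendsto (fun n : ℕ => (n : ℝ)⁻¹ * logPartition θ n) atTop (𝓝 (meanSoftplus θ 0)) := by
  refine tendsto_of_abs_sub_le (v := fun _ => meanSoftplus θ 0) (e := fun n : ℕ => (n : ℝ)⁻¹ * θ)
    tendsto_const_nhds ?_ ?_
  · simpa using tendsto_inv_atTop_nhds_zero_nat.mul_const θ
  · filter_upwards [eventually_ge_atTop 1] with n hn
    have hn' : (0 : ℝ) < n := Nat.cast_pos.2 hn
    obtain ⟨h1, h2⟩ := sum_softplus_le θ 0 hθ hn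
    rw [← logPartition] at h1 h2
    have e : (n : ℝ)⁻¹ * logPartition θ n - meanSoftplus θ 0 =
        (n : ℝ)⁻¹ * (logPartition θ n - n * meanSoftplus θ 0) := by
      field_simp
    rw [e, abs_mul, abs_of_pos (inv_pos.2 hn')]
    refine mul_le_mul_of_nonneg_left ?_ (inv_pos.2 hn').le
    rw [abs_le]
    constructor <;> linarith

/-- The power sum of a product law factorises over bits, and raising a Boltzmann weight to the power
s replaces β by sβ. -/
theorem sum_softNoise_rpow (β : ℝ) (n : ℕ) (τ : Equiv.Perm (Fin n)) (s : ℝ) :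
    ∑ z, softNoise β n τ z ^ s =
      Real.exp (logPartition (s * β) n - s * logPartition β n) := by
  have h1 : ∀ z : Word n, softNoise β n τ z ^ s =
      ∏ i, if z i = true then flipProb β n (τ i) ^ s
        else (1 - flipProb β n (τ i)) ^ s := fun z => by
    rw [softNoise, ← Real.finsetProd_rpow]
    · refine Finset.prod_congr rfl fun i _ => ?_
      split_ifs <;> rfl
    · intro i _
      split_ifs
      · exact (flipProb_pos β n _).le
      · exact (one_sub_flipProb_pos β n _).le
  have h2 := Finset.prod_univ_sum (fun _ : Fin n => (Finset.univ : Finset Bool))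
    (f := fun i b => if b = true then flipProb β n (τ i) ^ s else (1 - flipProb β n (τ i)) ^ s)
  rw [Fintype.piFinset_univ] at h2
  rw [Finset.sum_congr rfl fun z _ => h1 z, ← h2]
  simp only [Fintype.sum_bool, if_true, Bool.false_eq_true, if_false]
  rw [Equiv.prod_comp τ fun j => flipProb β n j ^ s + (1 - flipProb β n j) ^ s,
    logPartition, logPartition, Finset.mul_sum, ← Finset.sum_sub_distrib, Real.exp_sum]
  refine Finset.prod_congr rfl fun j _ => ?_
  rw [one_sub_flipProb_eq, flipProb_eq, ← Real.exp_add, ← Real.exp_mul, ← Real.exp_mul,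
    sub_eq_add_neg, Real.exp_add (softplus _), exp_softplus, one_add_mul, ← Real.exp_add,
    add_comm]
  congr 2 <;> ring

/-- The exponential growth rate of the power sums of the soft-decision noise effect. -/
noncomputable def softRate (β s : ℝ) : ℝ := meanSoftplus (s * β) 0 - s * meanSoftplus β 0

theorem tendsto_softRate {β : ℝ} (hβ : 0 < β) (τ : (n : ℕ) → Equiv.Perm (Fin n)) {s : ℝ}
    (hs : 0 < s) :
    Tendsto (fun n : ℕ => (n : ℝ)⁻¹ * Real.log (∑ z, softNoise β n (τ n) z ^ s)) atTop
      (𝓝 (softRate β s)) := by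
  have h := (tendsto_logPartition (mul_pos hs hβ).le).sub
    ((tendsto_logPartition hβ.le).const_mul s)
  refine h.congr fun n => ?_
  rw [sum_softNoise_rpow, Real.log_exp]
  ring

theorem tendsto_log_softNoise_zero {β : ℝ} (hβ : 0 < β) (τ : (n : ℕ) → Equiv.Perm (Fin n)) :
    Tendsto (fun n : ℕ => (n : ℝ)⁻¹ * Real.log (softNoise β n (τ n) fun _ => false)) atTop
      (𝓝 (-meanSoftplus β 0)) := by
  refine (tendsto_logPartition hβ.le).neg.congr fun n => ?_
  rw [softNoise_zero, Real.log_exp]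
  ring

/-! ### Power sums of the hard-decision noise -/

theorem hardNoise_pos (β : ℝ) (n : ℕ) (z : Word n) : 0 < hardNoise β n z :=
  div_pos (Finset.sum_pos (fun τ _ => softNoise_pos β n τ z) Finset.univ_nonempty)
    (Nat.cast_pos.2 n.factorial_pos)

theorem hardNoise_zero (β : ℝ) (n : ℕ) :
    hardNoise β n (fun _ => false) = Real.exp (-logPartition β n) := by
  have : (n.factorial : ℝ) ≠ 0 := Nat.cast_ne_zero.2 n.factorial_ne_zero
  simp only [hardNoise, softNoise_zero, Finset.sum_const, Finset.card_univ, Fintype.card_perm,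
    Fintype.card_fin, nsmul_eq_mul]
  field_simp

theorem hardNoise_le_zero {β : ℝ} (hβ : 0 < β) (n : ℕ) (z : Word n) :
    hardNoise β n z ≤ hardNoise β n fun _ => false :=
  div_le_div_of_nonneg_right (Finset.sum_le_sum fun τ _ => softNoise_le_zero hβ n τ z)
    (Nat.cast_nonneg _)

theorem tendsto_log_hardNoise_zero {β : ℝ} (hβ : 0 < β) :
    Tendsto (fun n : ℕ => (n : ℝ)⁻¹ * Real.log (hardNoise β n fun _ => false)) atTop
      (𝓝 (-meanSoftplus β 0)) := by
  refine (tendsto_logPartition hβ.le).neg.congr fun n => ?_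
  rw [hardNoise_zero, Real.log_exp]
  ring

/-- The word with support `S`. -/
def wordOf {n : ℕ} (S : Finset (Fin n)) : Word n := fun i => decide (i ∈ S)

theorem sum_word_eq {n : ℕ} (f : Word n → ℝ) :
    ∑ z, f z = ∑ k ∈ Finset.range (n + 1), ∑ S ∈ Finset.univ.powersetCard k, f (wordOf S) := by
  have h := Finset.sum_powerset (Finset.univ : Finset (Fin n)) fun S => f (wordOf S)
  rw [Finset.card_univ, Fintype.card_fin, Finset.powerset_univ] at h
  rw [← h]
  symm
  refine Fintype.sum_bijective wordOf ⟨fun S T hST => ?_, fun z => ?_⟩ _ _ fun _ => rfl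
  · ext i
    have := congrFun hST i
    simpa [wordOf] using this
  · refine ⟨Finset.univ.filter fun i => z i = true, ?_⟩
    funext i
    simp [wordOf]

theorem sum_perm_prod_eq {n : ℕ} (x : Fin n → ℝ) {S T : Finset (Fin n)} (h : S.card = T.card) :
    ∑ τ : Equiv.Perm (Fin n), ∏ i ∈ S, x (τ i) = ∑ τ : Equiv.Perm (Fin n), ∏ i ∈ T, x (τ i) := by
  have e : {i // i ∈ S} ≃ {i // i ∈ T} := Fintype.equivOfCardEq (by simpa using h)
  set π : Equiv.Perm (Fin n) := e.extendSubtype with hπ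
  have hT : S.map π.toEmbedding = T := by
    refine Finset.eq_of_subset_of_card_le (fun j hj => ?_) (by rw [Finset.card_map, h])
    obtain ⟨i, hi, rfl⟩ := Finset.mem_map.1 hj
    exact e.extendSubtype_mem i hi
  rw [← Equiv.sum_comp (Equiv.mulRight π)]
  refine Finset.sum_congr rfl fun τ _ => ?_
  rw [← hT, Finset.prod_map]
  rfl

theorem esymmSum_comp_perm {n : ℕ} (x : Fin n → ℝ) (τ : Equiv.Perm (Fin n)) (k : ℕ) :
    ∑ S ∈ (Finset.univ : Finset (Fin n)).powersetCard k, ∏ i ∈ S, x (τ i) =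
      esymmSum Finset.univ x k := by
  refine Finset.sum_equiv τ.finsetCongr (fun S => ?_) fun S _ => ?_
  · simp [Finset.mem_powersetCard]
  · rw [Equiv.finsetCongr_apply, Finset.prod_map]
    rfl

/-- Double counting over pairs (T, τ) with |T| = k: the sum over T is the same symmetric polynomial
for each τ, while the sum over τ is the same for each T by relabelling. -/
theorem hardNoise_wordOf (β : ℝ) {n k : ℕ} {S : Finset (Fin n)} (hS : S.card = k) :
    hardNoise β n (wordOf S) =
      Real.exp (-logPartition β n) * weightSum β n k / n.choose k := by
  set x : Fin n → ℝ := fun j => Real.exp (-β * ((j : ℝ) + 1) / n) with hx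
  have hk : k ≤ n := by simpa [hS] using Finset.card_le_univ S
  have hc : (n.choose k : ℝ) ≠ 0 := Nat.cast_ne_zero.2 (Nat.choose_pos hk).ne'
  have hf : (n.factorial : ℝ) ≠ 0 := Nat.cast_ne_zero.2 n.factorial_ne_zero
  have h1 : ∑ T ∈ (Finset.univ : Finset (Fin n)).powersetCard k,
      ∑ τ : Equiv.Perm (Fin n), ∏ i ∈ T, x (τ i) = n.factorial * weightSum β n k := by
    rw [Finset.sum_comm]
    simp only [esymmSum_comp_perm, Finset.sum_const, Finset.card_univ, Fintype.card_perm,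
      Fintype.card_fin, nsmul_eq_mul]
    rfl
  have h2 : ∑ T ∈ (Finset.univ : Finset (Fin n)).powersetCard k,
      ∑ τ : Equiv.Perm (Fin n), ∏ i ∈ T, x (τ i) =
      n.choose k * ∑ τ : Equiv.Perm (Fin n), ∏ i ∈ S, x (τ i) := by
    rw [Finset.sum_congr rfl fun T hT => sum_perm_prod_eq x
      ((Finset.mem_powersetCard.1 hT).2.trans hS.symm)]
    simp
  have h3 : ∑ τ : Equiv.Perm (Fin n), softNoise β n τ (wordOf S) =
      Real.exp (-logPartition β n) * ∑ τ : Equiv.Perm (Fin n), ∏ i ∈ S, x (τ i) := by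
    rw [Finset.mul_sum]
    refine Finset.sum_congr rfl fun τ _ => ?_
    rw [softNoise_eq_exp_mul]
    simp [wordOf, hx]
  rw [hardNoise, h3, div_eq_div_iff hf hc]
  linear_combination Real.exp (-logPartition β n) * (h1 - h2)

/-- The exponent of the contribution of the words of weight `k` to the power sum. -/
noncomputable def weightExponent (β s : ℝ) (n k : ℕ) : ℝ :=
  (1 - s) * Real.log (n.choose k) + s * (Real.log (weightSum β n k) - logPartition β n)

theorem sum_hardNoise_rpow (β s : ℝ) (n : ℕ) :
    ∑ z, hardNoise β n z ^ s = ∑ k ∈ Finset.range (n + 1), Real.exp (weightExponent β s n k) := by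
  rw [sum_word_eq]
  refine Finset.sum_congr rfl fun k hk => ?_
  have hk : k ≤ n := Nat.lt_succ_iff.1 (Finset.mem_range.1 hk)
  have hc : (0 : ℝ) < n.choose k := Nat.cast_pos.2 (Nat.choose_pos hk)
  have hw := weightSum_pos β hk
  rw [Finset.sum_congr rfl fun S hS => by
    rw [hardNoise_wordOf β (Finset.mem_powersetCard.1 hS).2]]
  rw [Finset.sum_const, Finset.card_powersetCard, Finset.card_univ, Fintype.card_fin,
    nsmul_eq_mul, Real.rpow_def_of_pos (by positivity), Real.log_div (by positivity) hc.ne',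
    Real.log_mul (by positivity) hw.ne', Real.log_exp]
  nth_rewrite 1 [← Real.exp_log hc]
  rw [← Real.exp_add, weightExponent]
  congr 1
  ring

/-- The exponential rate of the contribution of the words of weight `κ n` to the power sum of
order `s` of the hard-decision noise effect. -/
noncomputable def weightProfile (β s κ : ℝ) : ℝ :=
  (1 - s) * Real.binEntropy κ + s * (weightRate β κ - meanSoftplus β 0)

/-- The exponential growth rate of the power sums of the hard-decision noise effect. -/
noncomputable def hardRate (β s : ℝ) : ℝ := ⨆ κ : Set.Icc (0 : ℝ) 1, weightProfile β s κ

theorem weightRate_le_meanSoftplus {β κ : ℝ} (hβ : 0 ≤ β) (h0 : 0 ≤ κ) (h1 : κ ≤ 1) :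
    weightRate β κ ≤ meanSoftplus β 0 := by
  simpa using weightRate_le hβ h0 h1 0

theorem weightProfile_le {β s κ : ℝ} (hβ : 0 ≤ β) (hs : 0 < s) (h0 : 0 ≤ κ) (h1 : κ ≤ 1) :
    weightProfile β s κ ≤ |1 - s| * Real.log 2 := by
  have a := weightRate_le_meanSoftplus hβ h0 h1
  have b : (1 - s) * Real.binEntropy κ ≤ |1 - s| * Real.log 2 :=
    mul_le_mul (le_abs_self _) Real.binEntropy_le_log_two (Real.binEntropy_nonneg h0 h1)
      (abs_nonneg _)
  unfold weightProfile
  nlinarith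

theorem weightProfile_le_hardRate {β s κ : ℝ} (hβ : 0 ≤ β) (hs : 0 < s) (h0 : 0 ≤ κ)
    (h1 : κ ≤ 1) : weightProfile β s κ ≤ hardRate β s :=
  le_ciSup (f := fun κ : Set.Icc (0 : ℝ) 1 => weightProfile β s κ)
    ⟨|1 - s| * Real.log 2, by rintro _ ⟨κ, rfl⟩; exact weightProfile_le hβ hs κ.2.1 κ.2.2⟩
    ⟨κ, h0, h1⟩

theorem abs_weightExponent_sub_le {β s : ℝ} (hβ : 0 ≤ β) (hs : 0 < s) {n k : ℕ} (hn : 0 < n)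
    (hk : k ≤ n) :
    |(n : ℝ)⁻¹ * weightExponent β s n k - weightProfile β s (k / n)| ≤
      (n : ℝ)⁻¹ * (|1 - s| * Real.log (n + 1) + s * (β + Real.log (n + 1))) := by
  have hn' : (0 : ℝ) < n := Nat.cast_pos.2 hn
  have hl : 0 ≤ Real.log ((n : ℝ) + 1) := Real.log_nonneg (by linarith)
  have b1 := inv_mul_log_choose_le hn hk
  have b2 := binEntropy_sub_le hn hk
  have a1 := inv_mul_log_weightSum_le hβ hn hk
  have a2 := weightRate_sub_le hβ hn hk
  obtain ⟨c1, c2⟩ := sum_softplus_le β 0 hβ hn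
  rw [← logPartition] at c1 c2
  have c1' : (n : ℝ)⁻¹ * logPartition β n ≤ meanSoftplus β 0 := by rwa [inv_mul_le_iff₀ hn']
  have c2' : meanSoftplus β 0 - (n : ℝ)⁻¹ * β ≤ (n : ℝ)⁻¹ * logPartition β n := by
    rw [le_inv_mul_iff₀ hn', mul_sub, mul_inv_cancel_left₀ hn'.ne']
    linarith
  have e : (n : ℝ)⁻¹ * weightExponent β s n k - weightProfile β s (k / n) =
      (1 - s) * ((n : ℝ)⁻¹ * Real.log (n.choose k) - Real.binEntropy (k / n)) +
      s * (((n : ℝ)⁻¹ * Real.log (weightSum β n k) - weightRate β (k / n)) +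
        (meanSoftplus β 0 - (n : ℝ)⁻¹ * logPartition β n)) := by
    rw [weightExponent, weightProfile]; ring
  have e' : (n : ℝ)⁻¹ * (|1 - s| * Real.log (n + 1) + s * (β + Real.log (n + 1))) =
      |1 - s| * ((n : ℝ)⁻¹ * Real.log (n + 1)) + s * ((n : ℝ)⁻¹ * (β + Real.log (n + 1))) := by
    ring
  rw [e, e']
  refine (abs_add_le _ _).trans (add_le_add ?_ ?_)
  · rw [abs_mul]
    refine mul_le_mul_of_nonneg_left ?_ (abs_nonneg _)
    rw [abs_le]
    constructor
    · linarith
    · have : 0 ≤ (n : ℝ)⁻¹ * Real.log (n + 1) := by positivity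
      linarith
  · rw [abs_mul, abs_of_pos hs]
    refine mul_le_mul_of_nonneg_left ?_ hs.le
    have e3 : (n : ℝ)⁻¹ * (β + Real.log (n + 1)) =
      (n : ℝ)⁻¹ * β + (n : ℝ)⁻¹ * Real.log (n + 1) := by ring
    have : 0 ≤ (n : ℝ)⁻¹ * Real.log (n + 1) := by positivity
    rw [abs_le]
    constructor <;> linarith

/-- Interior weights use floors and continuity. The endpoints are hit by k = 0 and k = n, since
continuity there is not known. -/
theorem exists_tendsto_weightProfile {β : ℝ} (hβ : 0 ≤ β) (s : ℝ) {κ : ℝ} (h0 : 0 ≤ κ)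
    (h1 : κ ≤ 1) : ∃ k : ℕ → ℕ, (∀ n, k n ≤ n) ∧
      Tendsto (fun n : ℕ => weightProfile β s (k n / n)) atTop (𝓝 (weightProfile β s κ)) := by
  rcases h0.eq_or_lt with rfl | h0
  · exact ⟨fun _ => 0, fun n => n.zero_le, by simp⟩
  rcases h1.eq_or_lt with rfl | h1
  · refine ⟨fun n => n, fun n => le_rfl, tendsto_const_nhds.congr' ?_⟩
    filter_upwards [eventually_ge_atTop 1] with n hn
    rw [div_self (by positivity)]
  · refine ⟨fun n => ⌊κ * n⌋₊, fun n => ?_, ?_⟩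
    · refine Nat.floor_le_of_le ?_
      have : (0 : ℝ) ≤ n := Nat.cast_nonneg n
      nlinarith
    · have hlim : Tendsto (fun n : ℕ => (⌊κ * n⌋₊ : ℝ) / n) atTop (𝓝 κ) :=
        (tendsto_nat_floor_mul_div_atTop h0.le).comp tendsto_natCast_atTop_atTop
      have hcont : ContinuousAt (weightProfile β s) κ := by
        have hg : ContinuousAt (weightRate β) κ :=
          (continuousOn_weightRate hβ).continuousAt (Ioo_mem_nhds h0 h1)
        have hh : ContinuousAt Real.binEntropy κ := Real.binEntropy_continuous.continuousAt
        exact (hh.const_mul _).add ((hg.sub continuousAt_const).const_mul _)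
      exact hcont.tendsto.comp hlim

/-- Laplace principle: the power sum has only n + 1 weight classes, so it is governed by the largest
one. -/
theorem tendsto_hardRate {β : ℝ} (hβ : 0 < β) {s : ℝ} (hs : 0 < s) :
    Tendsto (fun n : ℕ => (n : ℝ)⁻¹ * Real.log (∑ z, hardNoise β n z ^ s)) atTop
      (𝓝 (hardRate β s)) := by
  have hl := tendsto_inv_mul_log_add_one
  have hε : Tendsto (fun n : ℕ => (n : ℝ)⁻¹ * (|1 - s| * Real.log (n + 1) +
      s * (β + Real.log (n + 1)))) atTop (𝓝 0) := by
    have h := (hl.const_mul (|1 - s| + s)).add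
      (tendsto_inv_atTop_nhds_zero_nat (𝕜 := ℝ).mul_const (s * β))
    rw [mul_zero, zero_mul, add_zero] at h
    refine h.congr fun n => ?_
    ring
  set ε : ℕ → ℝ := fun n => (n : ℝ)⁻¹ * (|1 - s| * Real.log (n + 1) +
      s * (β + Real.log (n + 1))) with hεdef
  simp_rw [sum_hardNoise_rpow]
  rw [tendsto_order]
  constructor
  · intro a ha
    obtain ⟨κ, hκ⟩ := exists_lt_of_lt_ciSup ha
    obtain ⟨k, hk, hlim⟩ := exists_tendsto_weightProfile hβ.le s κ.2.1 κ.2.2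
    have h1 := hlim.sub hε
    rw [sub_zero] at h1
    filter_upwards [h1.eventually_const_lt hκ, eventually_ge_atTop 1] with n hn hn1
    have hn' : (0 : ℝ) < n := Nat.cast_pos.2 hn1
    refine hn.trans_le ?_
    have h2 := (abs_le.1 (abs_weightExponent_sub_le hβ.le hs hn1 (hk n))).1
    have h3 : weightExponent β s n (k n) ≤
        Real.log (∑ k ∈ Finset.range (n + 1), Real.exp (weightExponent β s n k)) := by
      rw [← Real.log_exp (weightExponent β s n (k n))]
      refine Real.log_le_log (Real.exp_pos _) ?_
      exact Finset.single_le_sum (f := fun k => Real.exp (weightExponent β s n k))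
        (fun _ _ => (Real.exp_pos _).le) (Finset.mem_range.2 (Nat.lt_succ_of_le (hk n)))
    have h4 := mul_le_mul_of_nonneg_left h3 (inv_pos.2 hn').le
    simp only [hεdef]
    linarith
  · intro a ha
    have h1 := (hε.add hl).const_add (hardRate β s)
    rw [add_zero, add_zero] at h1
    filter_upwards [h1.eventually_lt_const ha, eventually_ge_atTop 1] with n hn hn1
    have hn' : (0 : ℝ) < n := Nat.cast_pos.2 hn1
    refine lt_of_le_of_lt ?_ hn
    have h2 : ∑ k ∈ Finset.range (n + 1), Real.exp (weightExponent β s n k) ≤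
        (n + 1) * Real.exp (n * (hardRate β s + ε n)) := by
      have := Finset.sum_le_card_nsmul (Finset.range (n + 1))
        (fun k => Real.exp (weightExponent β s n k)) (Real.exp (n * (hardRate β s + ε n)))
        fun k hk => by
          have hk : k ≤ n := Nat.lt_succ_iff.1 (Finset.mem_range.1 hk)
          have h2 := (abs_le.1 (abs_weightExponent_sub_le hβ.le hs hn1 hk)).2
          have h3 := weightProfile_le_hardRate hβ.le hs (κ := (k : ℝ) / n) (by positivity)
            (div_le_one_of_le₀ (Nat.cast_le.2 hk) hn'.le)
          refine Real.exp_le_exp.2 ?_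
          rw [← inv_mul_le_iff₀ hn']
          simp only [hεdef]
          linarith
      rw [Finset.card_range, nsmul_eq_mul] at this
      exact_mod_cast this
    have h3 := Real.log_le_log
      (Finset.sum_pos (fun _ _ => Real.exp_pos _) (Finset.nonempty_range_add_one)) h2
    rw [Real.log_mul (by positivity) (by positivity), Real.log_exp] at h3
    have h4 := mul_le_mul_of_nonneg_left h3 (inv_pos.2 hn').le
    rw [mul_add, inv_mul_cancel_left₀ hn'.ne'] at h4
    linarith

/-! ### Strict comparison of the two rates -/

theorem exists_binEntropy_eq {κ : ℝ} (h0 : 0 < κ) (h1 : κ < 1) :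
    ∃ t, Real.binEntropy κ = softplus t - t * κ := by
  obtain ⟨t, rfl⟩ := exists_sigmoid_eq h0 h1
  exact ⟨t, binEntropy_sigmoid t⟩

/-- Test the supremum at the typical weight κ of the channel with parameter sβ. There t = 0
minimises M(sβ,t) - tκ, so the soft rate lies below the convex combination of the dual expressions
for h(κ) and g(κ). -/
theorem softRate_lt_hardRate {β s : ℝ} (hβ : 0 < β) (hs0 : 0 < s) (hs1 : s < 1) :
    softRate β s < hardRate β s := by
  have h0 := meanWeight_pos (s * β) 0
  have h1 := meanWeight_lt_one (s * β) 0
  refine lt_of_lt_of_le ?_ (weightProfile_le_hardRate hβ.le hs0 h0.le h1.le)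
  set κ := meanWeight (s * β) 0 with hκ
  obtain ⟨t₀, ht₀⟩ := exists_binEntropy_eq h0 h1
  obtain ⟨t₁, ht₁⟩ := exists_weightRate_eq hβ.le h0 h1
  have hj := meanSoftplus_jensen_lt hβ hs0 hs1 t₀ t₁
  have ht := meanSoftplus_tangent_le (s * β) 0 (s * β) ((1 - s) * t₀ + s * t₁)
  rw [← hκ, sub_self, mul_zero] at ht
  rw [softRate, weightProfile, ht₀, ht₁]
  linarith

/-- Let t tend to -∞, by t = ln ε. The two endpoint weights need separate bounds because binary
entropy has no tangent representation there. -/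
theorem weightRate_zero_le {β : ℝ} (hβ : 0 ≤ β) : weightRate β 0 ≤ 0 := by
  refine le_of_forall_gt_imp_ge_of_dense fun ε hε => ?_
  refine (weightRate_le hβ le_rfl zero_le_one (Real.log ε)).trans ?_
  have := (meanSoftplus_le_softplus hβ (Real.log ε)).trans (softplus_le_exp _)
  rw [Real.exp_log hε] at this
  linarith

theorem weightRate_one_le {β : ℝ} (hβ : 0 ≤ β) : weightRate β 1 ≤ 0 := by
  refine le_of_forall_gt_imp_ge_of_dense fun ε hε => ?_
  refine (weightRate_le hβ zero_le_one le_rfl (-Real.log ε)).trans ?_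
  have h1 := meanSoftplus_le_softplus hβ (-Real.log ε)
  have h2 : softplus (-Real.log ε) = softplus (Real.log ε) - Real.log ε := by
    rw [softplus, softplus, Real.exp_neg, Real.exp_log hε]
    rw [show 1 + ε⁻¹ = (1 + ε) / ε by field_simp; ring,
      Real.log_div (by positivity) hε.ne']
  have h3 := softplus_le_exp (Real.log ε)
  rw [Real.exp_log hε] at h3
  linarith

theorem weightProfile_lt_softRate {β s κ : ℝ} (hβ : 0 < β) (hs : 1 < s) (h0 : 0 ≤ κ)
    (h1 : κ ≤ 1) : weightProfile β s κ < softRate β s := by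
  have hs0 : 0 < s := by linarith
  have hpos : 0 < meanSoftplus (s * β) 0 :=
    (softplus_pos _).trans_le (softplus_sub_le_meanSoftplus (by positivity) 0)
  unfold weightProfile softRate
  rcases h0.eq_or_lt with rfl | h0
  · have := weightRate_zero_le hβ.le
    rw [Real.binEntropy_zero]
    nlinarith
  rcases h1.eq_or_lt with rfl | h1
  · have := weightRate_one_le hβ.le
    rw [Real.binEntropy_one]
    nlinarith
  obtain ⟨t₀, ht₀⟩ := exists_binEntropy_eq h0 h1
  -- The point (β, (1 - 1/s) t₀) is the convex combination of (0, t₀) and (sβ, 0) with weights 1 -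
  -- 1/s and 1/s.
  have hj := meanSoftplus_jensen_lt (β := s * β) (s := s⁻¹) (by positivity) (inv_pos.2 hs0)
    (inv_lt_one_of_one_lt₀ hs) t₀ 0
  rw [inv_mul_cancel_left₀ hs0.ne', mul_zero, add_zero] at hj
  have hg := weightRate_le hβ.le h0.le h1.le ((1 - s⁻¹) * t₀)
  have h2 := mul_lt_mul_of_pos_left (hg.trans_lt (sub_lt_sub_right hj _)) hs0
  have e : s * ((1 - s⁻¹) * softplus t₀ + s⁻¹ * meanSoftplus (s * β) 0 - (1 - s⁻¹) * t₀ * κ) =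
      (s - 1) * (softplus t₀ - t₀ * κ) + meanSoftplus (s * β) 0 := by
    field_simp
    ring
  rw [e] at h2
  rw [ht₀]
  linarith

theorem upperSemicontinuousOn_weightProfile {β s : ℝ} (hβ : 0 ≤ β) (hs : 0 < s) :
    UpperSemicontinuousOn (weightProfile β s) (Set.Icc 0 1) := by
  have h1 : UpperSemicontinuousOn (fun κ => (1 - s) * Real.binEntropy κ) (Set.Icc 0 1) :=
    (Continuous.upperSemicontinuous (by fun_prop)).upperSemicontinuousOn _
  have h2 : UpperSemicontinuousOn (fun κ => s * (weightRate β κ - meanSoftplus β 0))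
      (Set.Icc 0 1) :=
    Continuous.comp_upperSemicontinuousOn (g := fun y => s * (y - meanSoftplus β 0))
      (by fun_prop) (upperSemicontinuousOn_weightRate hβ)
      fun a b hab => mul_le_mul_of_nonneg_left (sub_le_sub_right hab _) hs.le
  exact h1.add h2

/-- Pointwise strictness survives the supremum because upper semicontinuity on a compact interval
gives a maximiser. -/
theorem hardRate_lt_softRate {β s : ℝ} (hβ : 0 < β) (hs : 1 < s) :
    hardRate β s < softRate β s := by
  obtain ⟨κ, hκ, hmax⟩ := (upperSemicontinuousOn_weightProfile hβ.le
    (s := s) (by linarith)).exists_isMaxOn ⟨0, by simp⟩ isCompact_Icc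
  exact (ciSup_le fun κ' : Set.Icc (0 : ℝ) 1 => hmax κ'.2).trans_lt
    (weightProfile_lt_softRate hβ hs hκ.1 hκ.2)

/-! ### Derivatives at order one and the Shannon rates -/

/-- Binary entropy is not Lipschitz near 0 and 1, but chords from a fixed interior point have
bounded slope: concavity against the zeros at 0 and 1 bounds from below, the tangent at κ₀ from
above. -/
theorem exists_binEntropy_lipschitz {κ₀ : ℝ} (h0 : 0 < κ₀) (h1 : κ₀ < 1) :
    ∃ M : ℝ, 0 ≤ M ∧ ∀ κ, 0 ≤ κ → κ ≤ 1 →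
      |Real.binEntropy κ - Real.binEntropy κ₀| ≤ M * |κ - κ₀| := by
  obtain ⟨t, ht⟩ := exists_binEntropy_eq h0 h1
  have hh := (Real.binEntropy_pos h0 h1).le
  have h1' : 0 < 1 - κ₀ := by linarith
  set h := Real.binEntropy κ₀ with hdef
  have hA : 0 ≤ h / κ₀ := by positivity
  have hB : 0 ≤ h / (1 - κ₀) := by positivity
  refine ⟨|t| + h / κ₀ + h / (1 - κ₀), by positivity, fun κ hκ0 hκ1 => ?_⟩
  have conc : ∀ x ∈ Set.Icc (0 : ℝ) 1, ∀ w, 0 ≤ w → w ≤ 1 →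
      (1 - w) * Real.binEntropy x + w * h ≤ Real.binEntropy ((1 - w) * x + w * κ₀) :=
    fun x hx w hw0 hw1 => Real.strictConcave_binEntropy.concaveOn.2 hx ⟨h0.le, h1.le⟩
      (sub_nonneg.2 hw1) hw0 (sub_add_cancel 1 w)
  have hd := abs_nonneg (κ - κ₀)
  have m1 := mul_nonneg hA hd
  have m2 := mul_nonneg hB hd
  have m3 := mul_nonneg (abs_nonneg t) hd
  rw [abs_le]
  constructor
  · rcases le_total κ κ₀ with hle | hle
    · have c := conc 0 (by simp) (κ / κ₀) (by positivity) ((div_le_one h0).2 hle)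
      simp only [Real.binEntropy_zero, mul_zero, zero_add] at c
      rw [div_mul_cancel₀ _ h0.ne'] at c
      have e : h / κ₀ * |κ - κ₀| = h - κ / κ₀ * h := by
        rw [abs_of_nonpos (by linarith)]; field_simp; ring
      linarith
    · have c := conc 1 (by simp) ((1 - κ) / (1 - κ₀))
        (div_nonneg (by linarith) h1'.le) ((div_le_one h1').2 (by linarith))
      simp only [Real.binEntropy_one, mul_zero, zero_add] at c
      have e1 : (1 - (1 - κ) / (1 - κ₀)) * 1 + (1 - κ) / (1 - κ₀) * κ₀ = κ := by
        field_simp; ring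
      rw [e1] at c
      have e : h / (1 - κ₀) * |κ - κ₀| = h - (1 - κ) / (1 - κ₀) * h := by
        rw [abs_of_nonneg (by linarith)]; field_simp; ring
      linarith
  · have u := binEntropy_le_softplus_sub hκ0 hκ1 t
    have v := neg_abs_le (t * (κ - κ₀))
    rw [abs_mul] at v
    linarith

theorem weightRate_meanWeight {β : ℝ} (hβ : 0 ≤ β) :
    weightRate β (meanWeight β 0) = meanSoftplus β 0 := by
  refine le_antisymm (weightRate_le_meanSoftplus hβ (meanWeight_pos β 0).le
    (meanWeight_lt_one β 0).le) (le_ciInf fun t => ?_)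
  have := meanSoftplus_tangent_le β 0 β t
  rw [sub_self, mul_zero] at this
  linarith

/-- The Shannon entropy rate of the hard-decision noise effect. -/
noncomputable def hardEntropy (β : ℝ) : ℝ := Real.binEntropy (meanWeight β 0)

/-- The Shannon entropy rate of the soft-decision noise effect. -/
noncomputable def softEntropy (β : ℝ) : ℝ := meanSoftplus β 0 + β * meanEnergy β 0

/-- The tangent plane of M at (β,0), evaluated on θ = 0, lies strictly below softplus; the
intercepts are the two entropies. -/
theorem softEntropy_lt_hardEntropy {β : ℝ} (hβ : 0 < β) : softEntropy β < hardEntropy β := by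
  obtain ⟨t, ht⟩ := exists_binEntropy_eq (meanWeight_pos β 0) (meanWeight_lt_one β 0)
  have := meanSoftplus_tangent_lt hβ.ne' 0 t
  rw [meanSoftplus_zero_left] at this
  rw [softEntropy, hardEntropy, ht]
  linarith

theorem le_hardRate {β s : ℝ} (hβ : 0 ≤ β) (hs : 0 < s) :
    (1 - s) * hardEntropy β ≤ hardRate β s := by
  have := weightProfile_le_hardRate hβ hs (meanWeight_pos β 0).le (meanWeight_lt_one β 0).le
  rw [weightProfile, weightRate_meanWeight hβ, sub_self, mul_zero, add_zero] at this
  exact this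

theorem hardRate_one {β : ℝ} (hβ : 0 ≤ β) : hardRate β 1 = 0 := by
  refine le_antisymm (ciSup_le fun κ => ?_) ?_
  · simpa using weightProfile_le hβ one_pos κ.2.1 κ.2.2
  · simpa using le_hardRate hβ one_pos

/-- The typical weight gives the tangent from below. Above it, moving κ away gains at most linearly
in entropy, and the fall of the weight rate pays for this up to an error of order (s-1)². -/
theorem hasDerivAt_hardRate {β : ℝ} (hβ : 0 ≤ β) :
    HasDerivAt (hardRate β) (-hardEntropy β) 1 := by
  have h0 := meanWeight_pos β 0
  have h1 := meanWeight_lt_one β 0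
  obtain ⟨M, hM, hlip⟩ := exists_binEntropy_lipschitz h0 h1
  refine hasDerivAt_of_quadratic (C := 2 * M ^ 2) ?_ ?_
  · filter_upwards [lt_mem_nhds zero_lt_one] with s hs
    have := le_hardRate hβ hs
    rw [hardRate_one hβ]
    linarith
  · have hev : ∀ᶠ s : ℝ in 𝓝 1, |1 - s| * M / s < 1 := by
      have hc : ContinuousAt (fun s : ℝ => |1 - s| * M / s) 1 :=
        ContinuousAt.div (by fun_prop) continuousAt_id one_ne_zero
      exact hc.eventually_lt_const (by simp)
    filter_upwards [hev, lt_mem_nhds (show (1 / 2 : ℝ) < 1 by norm_num)] with s hs1 hs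
    have hs0 : 0 < s := by linarith
    -- Chosen so that s·t·|κ - κ*|, κ* the typical weight, cancels the Lipschitz gain |1-s|·M·|κ -
    -- κ*|. What is left is s·t², and s > 1/2 yields the factor 2.
    set t := |1 - s| * M / s with ht
    have ht0 : 0 ≤ t := by positivity
    have hst : s * t = |1 - s| * M := by rw [ht]; field_simp
    have hst2 : s * t ^ 2 ≤ 2 * M ^ 2 * (s - 1) ^ 2 := by
      have e : s * t ^ 2 = M ^ 2 * (s - 1) ^ 2 / s := by
        rw [ht, div_pow, mul_pow, sq_abs]; field_simp; ring
      rw [e, div_le_iff₀ hs0]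
      nlinarith [mul_nonneg (sq_nonneg M) (sq_nonneg (s - 1))]
    rw [hardRate_one hβ]
    refine ciSup_le fun κ => ?_
    obtain ⟨κ, hκ0, hκ1⟩ := κ
    have hl := hlip κ hκ0 hκ1
    rw [← hardEntropy] at hl
    have key : weightRate β κ - meanSoftplus β 0 ≤ t ^ 2 - t * |κ - meanWeight β 0| := by
      rcases le_total κ (meanWeight β 0) with hle | hle
      · have q := meanSoftplus_le_quadratic β 0 β (-t)
          (by simpa [abs_of_nonneg ht0] using hs1.le)
        have w := weightRate_le hβ hκ0 hκ1 (-t)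
        simp only [sub_zero, abs_neg, sub_self, abs_zero, add_zero, mul_zero, sq_abs] at q
        rw [abs_of_nonpos (by linarith)]
        linarith
      · have q := meanSoftplus_le_quadratic β 0 β t
          (by simpa [abs_of_nonneg ht0] using hs1.le)
        have w := weightRate_le hβ hκ0 hκ1 t
        simp only [sub_zero, sub_self, abs_zero, add_zero, mul_zero, sq_abs] at q
        rw [abs_of_nonneg (by linarith)]
        linarith
    have key2 := mul_le_mul_of_nonneg_left key hs0.le
    have key3 : (1 - s) * (Real.binEntropy κ - hardEntropy β) ≤
        |1 - s| * (M * |κ - meanWeight β 0|) := by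
      refine (le_abs_self _).trans ?_
      rw [abs_mul]
      exact mul_le_mul_of_nonneg_left hl (abs_nonneg _)
    have e : s * (t ^ 2 - t * |κ - meanWeight β 0|) =
        s * t ^ 2 - |1 - s| * M * |κ - meanWeight β 0| := by rw [← hst]; ring
    rw [e] at key2
    simp only [weightProfile]
    linarith

theorem softRate_one (β : ℝ) : softRate β 1 = 0 := by simp [softRate]

theorem hasDerivAt_softRate (β : ℝ) : HasDerivAt (softRate β) (-softEntropy β) 1 := by
  have h1 : HasDerivAt (fun s : ℝ => s * β) (1 * β) 1 := (hasDerivAt_id 1).mul_const β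
  have h2 : HasDerivAt (fun θ => meanSoftplus θ 0) (-meanEnergy (1 * β) 0) (1 * β) :=
    hasDerivAt_meanSoftplus_left _ 0
  have h3 := (h2.comp (1 : ℝ) h1).sub ((hasDerivAt_id (1 : ℝ)).mul_const (meanSoftplus β 0))
  refine h3.congr_deriv ?_
  rw [softEntropy, one_mul]
  ring

/-- The Rényi rate R(s)/(1-s) is minus the slope of R between 1 and s. -/
theorem isShannonRate_of_hasDerivAt {p : (n : ℕ) → Word n → ℝ} {R : ℝ → ℝ} {h : ℝ}
    (hR : ∀ s, 0 < s → Tendsto (fun n : ℕ => (n : ℝ)⁻¹ * Real.log (∑ z, p n z ^ s)) atTop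
      (𝓝 (R s))) (h1 : R 1 = 0) (hd : HasDerivAt R (-h) 1) : IsShannonRate p h := by
  refine ⟨fun s => 1 / (1 - s) * R s, fun s hs _ => ?_, ?_⟩
  · refine ((hR s hs).const_mul (1 / (1 - s))).congr fun n => ?_
    rw [renyiEntropy]
    ring
  · have := (hasDerivAt_iff_tendsto_slope.1 hd).neg
    rw [neg_neg] at this
    refine this.congr' ?_
    filter_upwards [self_mem_nhdsWithin] with s hs
    have hs : s - 1 ≠ 0 := sub_ne_zero.2 hs
    have hs' : 1 - s ≠ 0 := by rwa [← neg_ne_zero, neg_sub]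
    rw [slope_def_field, h1]
    field_simp
    ring

/-! ### Legendre transforms and their strict ordering -/

theorem guessScgf_of_lt {R : ℝ → ℝ} {m α : ℝ} (hα : -1 < α) :
    guessScgf R m α = (1 + α) * R (1 / (1 + α)) := if_pos hα

theorem guessScgf_of_le {R : ℝ → ℝ} {m α : ℝ} (hα : α ≤ -1) : guessScgf R m α = m :=
  if_neg (not_lt.2 hα)

theorem guessScgf_zero {R : ℝ → ℝ} (m : ℝ) (h1 : R 1 = 0) : guessScgf R m 0 = 0 := by
  rw [guessScgf_of_lt (by norm_num)]
  simp [h1]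

theorem hasDerivAt_guessScgf {R : ℝ → ℝ} {h : ℝ} (m : ℝ) (h1 : R 1 = 0)
    (hd : HasDerivAt R (-h) 1) : HasDerivAt (guessScgf R m) h 0 := by
  have d1 : HasDerivAt (fun α : ℝ => 1 + α) 1 0 := (hasDerivAt_id 0).const_add 1
  have d2 : HasDerivAt (fun α : ℝ => 1 / (1 + α)) (-1) 0 := by
    have := d1.fun_inv (by norm_num)
    simpa [one_div] using this
  have d3 : HasDerivAt (fun α : ℝ => R (1 / (1 + α))) (-h * -1) 0 :=
    HasDerivAt.comp (h₂ := R) (0 : ℝ) (by simpa using hd) d2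
  have d4 := d1.mul d3
  refine (d4.congr_deriv (by simp [h1])).congr_of_eventuallyEq ?_
  filter_upwards [lt_mem_nhds (show (-1 : ℝ) < 0 by norm_num)] with α hα
  exact guessScgf_of_lt hα

theorem tangent_le_of_convexOn {Λ : ℝ → ℝ} {h : ℝ} (hc : ConvexOn ℝ Set.univ Λ) (h0 : Λ 0 = 0)
    (hd : HasDerivAt Λ h 0) (α : ℝ) : h * α ≤ Λ α := by
  rcases lt_trichotomy α 0 with hα | rfl | hα
  · have := hc.slope_le_of_hasDerivAt (Set.mem_univ α) (Set.mem_univ 0) hα hd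
    rw [slope_def_field, h0, zero_sub, zero_sub, div_le_iff₀ (by linarith)] at this
    linarith
  · rw [h0, mul_zero]
  · have := hc.le_slope_of_hasDerivAt (Set.mem_univ 0) (Set.mem_univ α) hα hd
    rwa [slope_def_field, h0, sub_zero, sub_zero, le_div_iff₀ hα] at this

theorem exists_pos_of_ne {Λ : ℝ → ℝ} {h x : ℝ} (h0 : Λ 0 = 0) (hd : HasDerivAt Λ h 0)
    (hx : x ≠ h) : ∃ α, 0 < x * α - Λ α := by
  by_contra! hcon
  have hmax : IsLocalMax (fun α => x * α - Λ α) 0 :=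
    Eventually.of_forall fun α => by simpa [h0] using hcon α
  have hd' : HasDerivAt (fun α => x * α - Λ α) (x * 1 - h) 0 := ((hasDerivAt_id 0).const_mul x).sub hd
  have := hmax.hasDerivAt_eq_zero hd'
  exact hx (by linarith)

/-- A real number c is kept between the two suprema because a pointwise strict inequality alone
would not pass to them. -/
theorem rateFunction_lt_of_forall_le {Λ Λ' : ℝ → ℝ} {x c : ℝ} (h : ∀ α, x * α - Λ α ≤ c)
    (h' : ∃ α, c < x * α - Λ' α) : rateFunction Λ x < rateFunction Λ' x := by
  obtain ⟨α, hα⟩ := h'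
  calc rateFunction Λ x ≤ (c : EReal) := iSup_le fun α => EReal.coe_le_coe_iff.2 (h α)
    _ < ((x * α - Λ' α : ℝ) : EReal) := EReal.coe_lt_coe_iff.2 hα
    _ ≤ rateFunction Λ' x :=
      le_iSup (fun α : ℝ => ((x * α - Λ' α : ℝ) : EReal)) α

/-- The scaled cumulant generating function of soft-decision guesswork. -/
noncomputable def softScgf (β : ℝ) : ℝ → ℝ := guessScgf (softRate β) (-meanSoftplus β 0)

/-- The scaled cumulant generating function of hard-decision guesswork. -/
noncomputable def hardScgf (β : ℝ) : ℝ → ℝ := guessScgf (hardRate β) (-meanSoftplus β 0)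

variable {β : ℝ}

theorem isScgf_softScgf (hβ : 0 < β) (τ : (n : ℕ) → Equiv.Perm (Fin n))
    (G : (n : ℕ) → GuessFun n) (hG : ∀ n, IsOptimal (softNoise β n (τ n)) (G n)) :
    IsScgf (fun n => softNoise β n (τ n)) (fun n => guessExponent (G n)) (softScgf β) :=
  isScgf_guessScgf (fun n => softNoise_pos β n (τ n)) (fun _ hs => tendsto_softRate hβ τ hs)
    (fun _ _ => false) (fun n => softNoise_le_zero hβ n (τ n))
    (tendsto_log_softNoise_zero hβ τ) G hG

theorem isScgf_hardScgf (hβ : 0 < β) (G : (n : ℕ) → GuessFun n)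
    (hG : ∀ n, IsOptimal (hardNoise β n) (G n)) :
    IsScgf (fun n => hardNoise β n) (fun n => guessExponent (G n)) (hardScgf β) :=
  isScgf_guessScgf (hardNoise_pos β) (fun _ hs => tendsto_hardRate hβ hs)
    (fun _ _ => false) (hardNoise_le_zero hβ) (tendsto_log_hardNoise_zero hβ) G hG

theorem convexOn_softScgf (hβ : 0 < β) : ConvexOn ℝ Set.univ (softScgf β) := by
  choose G hG using fun n => exists_isOptimal (softNoise β n 1)
  exact convexOn_of_isScgf (fun n => softNoise_pos β n 1) (isScgf_softScgf hβ (fun _ => 1) G hG)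

theorem convexOn_hardScgf (hβ : 0 < β) : ConvexOn ℝ Set.univ (hardScgf β) := by
  choose G hG using fun n => exists_isOptimal (hardNoise β n)
  exact convexOn_of_isScgf (hardNoise_pos β) (isScgf_hardScgf hβ G hG)

theorem softScgf_zero (β : ℝ) : softScgf β 0 = 0 := guessScgf_zero _ (softRate_one β)

theorem hardScgf_zero (hβ : 0 < β) : hardScgf β 0 = 0 := guessScgf_zero _ (hardRate_one hβ.le)

theorem hasDerivAt_softScgf (β : ℝ) : HasDerivAt (softScgf β) (softEntropy β) 0 :=
  hasDerivAt_guessScgf _ (softRate_one β) (hasDerivAt_softRate β)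

theorem hasDerivAt_hardScgf (hβ : 0 < β) : HasDerivAt (hardScgf β) (hardEntropy β) 0 :=
  hasDerivAt_guessScgf _ (hardRate_one hβ.le) (hasDerivAt_hardRate hβ.le)

theorem softScgf_lt_hardScgf (hβ : 0 < β) {α : ℝ} (hα : 0 < α) : softScgf β α < hardScgf β α := by
  have h1 : 0 < 1 + α := by linarith
  rw [softScgf, hardScgf, guessScgf_of_lt (by linarith), guessScgf_of_lt (by linarith)]
  exact mul_lt_mul_of_pos_left (softRate_lt_hardRate hβ (one_div_pos.2 h1)
    ((div_lt_one h1).2 (by linarith))) h1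

theorem hardScgf_lt_softScgf (hβ : 0 < β) {α : ℝ} (hα : -1 < α) (hα0 : α < 0) :
    hardScgf β α < softScgf β α := by
  have h1 : 0 < 1 + α := by linarith
  rw [softScgf, hardScgf, guessScgf_of_lt hα, guessScgf_of_lt hα]
  exact mul_lt_mul_of_pos_left (hardRate_lt_softRate hβ ((one_lt_div h1).2 (by linarith))) h1

theorem softScgf_eq (β : ℝ) {α : ℝ} (hα : -1 < α) :
    softScgf β α = (1 + α) * meanSoftplus (β / (1 + α)) 0 - meanSoftplus β 0 := by
  have h1 : 1 + α ≠ 0 := by linarith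
  rw [softScgf, guessScgf_of_lt hα, softRate, one_div_mul_eq_div]
  field_simp

/-- The tangent of M at θ = 0 gives the asymptote as α → ∞; the quadratic bound below shows that the
distance to it is at most β²/(1+α). -/
theorem softScgf_lower (β : ℝ) {α : ℝ} (hα : -1 < α) :
    (1 + α) * Real.log 2 - meanEnergy 0 0 * β - meanSoftplus β 0 ≤ softScgf β α := by
  have h1 : 0 < 1 + α := by linarith
  have := mul_le_mul_of_nonneg_left (meanSoftplus_tangent_le 0 0 (β / (1 + α)) 0) h1.le
  rw [meanSoftplus_zero_left, softplus_zero] at this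
  rw [softScgf_eq β hα]
  have e : (1 + α) * (Real.log 2 + meanWeight 0 0 * (0 - 0) -
      meanEnergy 0 0 * (β / (1 + α) - 0)) = (1 + α) * Real.log 2 - meanEnergy 0 0 * β := by
    field_simp
    ring
  linarith

theorem softScgf_upper (hβ : 0 < β) {α : ℝ} (hα : -1 < α) (hβα : β ≤ 1 + α) :
    softScgf β α ≤ (1 + α) * Real.log 2 - meanEnergy 0 0 * β + β ^ 2 / (1 + α) -
      meanSoftplus β 0 := by
  have h1 : 0 < 1 + α := by linarith
  have hd : 0 < β / (1 + α) := by positivity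
  have := mul_le_mul_of_nonneg_left (meanSoftplus_le_quadratic 0 0 (β / (1 + α)) 0
    (by rw [sub_self, abs_zero, zero_add, sub_zero, abs_of_pos hd]; exact (div_le_one h1).2 hβα))
    h1.le
  rw [meanSoftplus_zero_left, softplus_zero, sub_self, abs_zero, zero_add, sub_zero,
    abs_of_pos hd] at this
  rw [softScgf_eq β hα]
  have e : (1 + α) * (Real.log 2 + meanWeight 0 0 * 0 -
      meanEnergy 0 0 * (β / (1 + α)) + (β / (1 + α)) ^ 2) =
      (1 + α) * Real.log 2 - meanEnergy 0 0 * β + β ^ 2 / (1 + α) := by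
    field_simp
    ring
  linarith

theorem log_two_sub_lt_weightRate (hβ : 0 < β) :
    Real.log 2 - meanEnergy 0 0 * β < weightRate β 2⁻¹ := by
  obtain ⟨t, ht⟩ := exists_weightRate_eq hβ.le (κ := 2⁻¹) (by norm_num) (by norm_num)
  have h := meanSoftplus_tangent_lt hβ.ne 0 t
  have hw : meanWeight 0 0 = 2⁻¹ := by simp [meanWeight, Real.sigmoid_zero]
  rw [meanSoftplus_zero_left, softplus_zero, hw] at h
  rw [ht]
  linarith

/-- Half-weight words have maximal entropy ln 2, so testing the supremum at κ = 1/2 gives a line of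
slope ln 2. -/
theorem hardScgf_lower (hβ : 0 < β) (α : ℝ) :
    α * Real.log 2 + weightRate β 2⁻¹ - meanSoftplus β 0 ≤ hardScgf β α := by
  rcases lt_or_ge (-1) α with hα | hα
  · have h1 : 0 < 1 + α := by linarith
    have := mul_le_mul_of_nonneg_left (weightProfile_le_hardRate hβ.le (one_div_pos.2 h1)
      (κ := 2⁻¹) (by norm_num) (by norm_num)) h1.le
    rw [hardScgf, guessScgf_of_lt hα]
    refine le_trans (le_of_eq ?_) this
    rw [weightProfile, Real.binEntropy_two_inv]
    field_simp
    ring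
  · have h2 : weightRate β 2⁻¹ ≤ Real.log 2 := by
      have := (weightRate_le_meanSoftplus hβ.le (κ := 2⁻¹) (by norm_num) (by norm_num)).trans
        (meanSoftplus_le_softplus hβ.le 0)
      rwa [softplus_zero] at this
    rw [hardScgf, guessScgf_of_le hα]
    have : 0 < Real.log 2 := Real.log_pos (by norm_num)
    nlinarith

theorem rateFunction_soft_lt_hard (hβ : 0 < β) {x : ℝ} (hx0 : 0 < x) (hx : x ≤ softEntropy β) :
    rateFunction (softScgf β) x < rateFunction (hardScgf β) x := by
  have hc := convexOn_softScgf hβ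
  have hcont : Continuous (softScgf β) := continuousOn_univ.1 (hc.continuousOn isOpen_univ)
  set F : ℝ → ℝ := fun α => x * α - softScgf β α with hF
  have hFc : Continuous F := by fun_prop
  obtain ⟨a, ha, hmax⟩ := isCompact_Icc.exists_isMaxOn (s := Set.Icc (-1 : ℝ) 0)
    ⟨0, by norm_num⟩ hFc.continuousOn
  have hF0 : F 0 = 0 := by simp [hF, softScgf_zero]
  have hall : ∀ α, F α ≤ F a := fun α => by
    rcases lt_or_ge α (-1) with h1 | h1
    · refine le_trans ?_ (hmax (show (-1 : ℝ) ∈ Set.Icc (-1 : ℝ) 0 by norm_num))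
      simp only [hF, softScgf]
      rw [guessScgf_of_le h1.le, guessScgf_of_le le_rfl]
      nlinarith
    rcases le_or_gt α 0 with h0 | h0
    · exact hmax ⟨h1, h0⟩
    · refine le_trans ?_ (hmax (show (0 : ℝ) ∈ Set.Icc (-1 : ℝ) 0 by norm_num))
      rw [hF0]
      have := tangent_le_of_convexOn hc (softScgf_zero β) (hasDerivAt_softScgf β) α
      simp only [hF]
      nlinarith
  -- For α ≤ -1 the two functions agree, so a maximiser at -1 would give no strict inequality. It is
  -- excluded because the soft function has right slope 0 at -1 while x > 0.
  have ha1 : -1 < a := by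
    refine lt_of_le_of_ne ha.1 fun h => ?_
    -- Moving from -1 to -1 + γ gains xγ and costs at most γ²/β; γ ≤ xβ/2 makes the gain win.
    have hγ : 0 < min 1 (x * β / 2) := lt_min one_pos (by positivity)
    set γ := min 1 (x * β / 2) with hγdef
    have h2 := hall (-1 + γ)
    rw [← h] at h2
    simp only [hF] at h2
    rw [softScgf_eq β (by linarith), softScgf, guessScgf_of_le le_rfl] at h2
    have e : 1 + (-1 + γ) = γ := by ring
    rw [e] at h2
    have h3 := mul_le_mul_of_nonneg_left (meanSoftplus_zero_le_inv (div_pos hβ hγ)) hγ.le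
    have h4 : γ * (1 / (β / γ)) = γ * γ / β := by field_simp
    have h5 : γ * γ / β < x * γ := by
      rw [div_lt_iff₀ hβ]
      have : γ ≤ x * β / 2 := min_le_right _ _
      nlinarith [mul_pos hx0 hβ]
    rw [h4] at h3
    linarith
  refine rateFunction_lt_of_forall_le hall ?_
  rcases ha.2.lt_or_eq with h | h
  · refine ⟨a, ?_⟩
    have := hardScgf_lt_softScgf hβ ha1 h
    simp only [hF]
    linarith
  · rw [h, hF0]
    exact exists_pos_of_ne (hardScgf_zero hβ) (hasDerivAt_hardScgf hβ)
      (hx.trans_lt (softEntropy_lt_hardEntropy hβ)).ne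

theorem rateFunction_hard_lt_soft_of_lt (hβ : 0 < β) {x : ℝ} (hx : hardEntropy β ≤ x)
    (hx2 : x < Real.log 2) : rateFunction (hardScgf β) x < rateFunction (softScgf β) x := by
  have hc := convexOn_hardScgf hβ
  have hcont : Continuous (hardScgf β) := continuousOn_univ.1 (hc.continuousOn isOpen_univ)
  set F : ℝ → ℝ := fun α => x * α - hardScgf β α with hF
  have hFc : Continuous F := by fun_prop
  have hF0 : F 0 = 0 := by simp [hF, hardScgf_zero hβ]
  have hx2' : 0 < Real.log 2 - x := by linarith
  set c := meanEnergy 0 0 * β + meanSoftplus β 0 with hcdef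
  -- Beyond A the linear lower bound on the soft function, hence on the larger hard one, already
  -- forces F < 0 = F 0. This needs x < ln 2.
  set A := max 0 (c / (Real.log 2 - x)) with hA
  have hA0 : 0 ≤ A := le_max_left _ _
  have hlog2 : 0 < Real.log 2 := Real.log_pos (by norm_num)
  obtain ⟨a, ha, hmax⟩ := isCompact_Icc.exists_isMaxOn (s := Set.Icc 0 A)
    ⟨0, le_rfl, hA0⟩ hFc.continuousOn
  have hFa : 0 ≤ F a := hF0 ▸ hmax (show (0 : ℝ) ∈ Set.Icc 0 A from ⟨le_rfl, hA0⟩)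
  have hall : ∀ α, F α ≤ F a := fun α => by
    rcases lt_or_ge α 0 with h0 | h0
    · refine le_trans ?_ hFa
      have := tangent_le_of_convexOn hc (hardScgf_zero hβ) (hasDerivAt_hardScgf hβ) α
      simp only [hF]
      nlinarith
    rcases le_or_gt α A with h1 | h1
    · exact hmax ⟨h0, h1⟩
    · refine le_trans ?_ hFa
      have h2 := softScgf_lt_hardScgf hβ (hA0.trans_lt h1)
      have h3 := softScgf_lower β (α := α) (by linarith)
      have h4 := (div_lt_iff₀ hx2').1 ((le_max_right _ _).trans_lt h1)
      simp only [hF]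
      linarith
  refine rateFunction_lt_of_forall_le hall ?_
  rcases ha.1.lt_or_eq with h | h
  · refine ⟨a, ?_⟩
    have := softScgf_lt_hardScgf hβ h
    simp only [hF]
    linarith
  · rw [← h, hF0]
    exact exists_pos_of_ne (softScgf_zero β) (hasDerivAt_softScgf β)
      ((softEntropy_lt_hardEntropy hβ).trans_le hx).ne'

/-- At the slope ln 2 the search for a maximiser is not confined to a compact interval. The hard
supremum is instead bounded through half-weight words, and the soft expression exceeds that bound
for large α by the strict gap between the asymptotes. -/
theorem rateFunction_hard_lt_soft_log_two (hβ : 0 < β) :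
    rateFunction (hardScgf β) (Real.log 2) < rateFunction (softScgf β) (Real.log 2) := by
  refine rateFunction_lt_of_forall_le (c := meanSoftplus β 0 - weightRate β 2⁻¹)
    (fun α => by linarith [hardScgf_lower hβ α]) ?_
  have hgap := sub_pos.2 (log_two_sub_lt_weightRate hβ)
  set δ := weightRate β 2⁻¹ - (Real.log 2 - meanEnergy 0 0 * β) with hδ
  -- γ stands for 1 + α: at least β for the quadratic bound to apply, and large enough that its
  -- error β²/γ is below the gap δ.
  obtain ⟨γ, hγ1, hγ2⟩ : ∃ γ : ℝ, β ≤ γ ∧ β ^ 2 / δ < γ :=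
    ⟨max β (β ^ 2 / δ + 1), le_max_left _ _, (lt_add_one _).trans_le (le_max_right _ _)⟩
  have hγ0 : 0 < γ := hβ.trans_le hγ1
  refine ⟨γ - 1, ?_⟩
  have h := softScgf_upper hβ (α := γ - 1) (by linarith) (by linarith)
  rw [add_sub_cancel] at h
  have h2 : β ^ 2 / γ < δ := by
    rw [div_lt_iff₀ hγ0]
    rw [div_lt_iff₀ hgap] at hγ2
    linarith
  linarith

theorem rateFunction_hard_lt_soft (hβ : 0 < β) {x : ℝ} (hx : hardEntropy β ≤ x)
    (hx2 : x ≤ Real.log 2) : rateFunction (hardScgf β) x < rateFunction (softScgf β) x := by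
  rcases hx2.lt_or_eq with h | rfl
  · exact rateFunction_hard_lt_soft_of_lt hβ hx h
  · exact rateFunction_hard_lt_soft_log_two hβ

end LRC

theorem mainTheorem7 (β : ℝ) (hβ : 0 < β) :
    ∃ (ΛN ΛZ : ℝ → ℝ) (HN HZ : ℝ),
      -- `ΛN` is the sCGF of soft-decision guesswork
      (∀ (τ : (n : ℕ) → Equiv.Perm (Fin n)) (G : (n : ℕ) → LRC.GuessFun n),
        (∀ n, LRC.IsOptimal (LRC.softNoise β n (τ n)) (G n)) →
        LRC.IsScgf (fun n => LRC.softNoise β n (τ n))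
          (fun n => LRC.guessExponent (G n)) ΛN) ∧
      -- `ΛZ` is the sCGF of hard-decision guesswork
      (∀ G : (n : ℕ) → LRC.GuessFun n,
        (∀ n, LRC.IsOptimal (LRC.hardNoise β n) (G n)) →
        LRC.IsScgf (fun n => LRC.hardNoise β n)
          (fun n => LRC.guessExponent (G n)) ΛZ) ∧
      -- `HN` and `HZ` are the Shannon entropy rates of the two noise effects
      (∀ τ : (n : ℕ) → Equiv.Perm (Fin n),
        LRC.IsShannonRate (fun n => LRC.softNoise β n (τ n)) HN) ∧
      LRC.IsShannonRate (fun n => LRC.hardNoise β n) HZ ∧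
      -- the strict ordering of the rate functions
      (∀ x : ℝ, 0 < x → x ≤ HN → LRC.rateFunction ΛN x < LRC.rateFunction ΛZ x) ∧
      (∀ x : ℝ, HZ ≤ x → x ≤ Real.log 2 →
        LRC.rateFunction ΛZ x < LRC.rateFunction ΛN x) := by
  exact ⟨LRC.softScgf β, LRC.hardScgf β, LRC.softEntropy β, LRC.hardEntropy β,
    LRC.isScgf_softScgf hβ, LRC.isScgf_hardScgf hβ,
    fun τ => LRC.isShannonRate_of_hasDerivAt (fun _ hs => LRC.tendsto_softRate hβ τ hs)
      (LRC.softRate_one β) (LRC.hasDerivAt_softRate β),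
    LRC.isShannonRate_of_hasDerivAt (fun _ hs => LRC.tendsto_hardRate hβ hs)
      (LRC.hardRate_one hβ.le) (LRC.hasDerivAt_hardRate hβ.le),
    fun _ => LRC.rateFunction_soft_lt_hard hβ, fun _ => LRC.rateFunction_hard_lt_soft hβ⟩
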